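/- **Setting.** Let $\Gamma$ be an infinite set of values. A schema $\mathcal G$ consists of relation names with arities, exactly one key $key(r)\subseteq\{1,\dots,arity(r)\}$ for each relation $r$ (all positions, if no key is specified), and a finite set of inclusion dependencies (INDs), possibly cyclic, of the form $\forall \vec x\,[r_1(\vec x_1)\to\exists\vec y\; r_2(\vec x_2)]$, where no variable is repeated within $\vec x_1$ or within $\vec x_2$ and $\vec y$ consists of the variables of $\vec x_2$ that do not occur in $\vec x_1$. For an IND $d$ let $\pi_R^d$ be the set of positions of $\vec x_2$ that hold a variable of $\vec x_1$; $d$ is *non-key-conflicting* (NKC) if $\pi_R^d\not\supsetneq key(r_2)$. A database is a (possibly infinite) set of facts over $\Gamma$; it is consistent if it satisfies all keys and all INDs. A consistent database $B$ is a *loosely-sound repair* of $D$ if there is no consistent $B'$ with $B'\cap D\supsetneq B\cap D$. For a union of conjunctive queries (UCQ) $q$ without comparison atoms (terms are variables or constants, and each output variable occurs in an atom of the body), $ans(q,\mathcal G,D)$ is the set of tuples that are answers to $q$ in every loosely-sound repair of $D$. **Program.** $Q$ is the perfect rewriting of $q$: starting with the disjuncts of $q$, iterate the following two steps and keep everything obtained.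 (1) If two atoms of a conjunctive query (CQ) in the current set unify, add the CQ obtained by applying their most general unifier and replacing them by the single unifying atom. (2) If an atom $r_2(\vec u)$ of a CQ in the current set and an IND $d$ from $r_1$ to $r_2$ are such that the positions of $\vec u$ outside $\pi_R^d$ hold only non-output variables that occur exactly once in the CQ, add the CQ in which this atom is replaced by the $r_1$-atom that carries the terms of $\vec u$ along $d$ and anonymous variables elsewhere. $P_{cqa}$ is the disjunctive logic program, under the answer set semantics, with the following rules. For each relation $g$ and each $i\notin key(g)$ it has $$g^c(\vec x_1)\vee g^c(\vec x_2) \leftarrow g(\vec x_1),\, g(\vec x_2),\, x_1^i\ne x_2^i,$$ where $\vec x_1,\vec x_2$ are sequences of distinct variables that coincide exactly on $key(g)$; for each relation $g$ it has $$g^r(\vec x)\leftarrow g(\vec x),\ \mathrm{not}\ g^c(\vec x);$$ and for each CQ in $Q$ it has the rule with head predicate $Q_{cqa}$ whose body is that of the CQ with each atom $g(\vec y)$ replaced by $g^r(\vec y)$. A ground atom is a *cautious consequence* of a program if it belongs to all its answer sets. **Theorem.** Let $D$ be a finite database for a schema $\mathcal G$ with exactly one key for each relation and (possibly cyclic) NKC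 INDs, and let $q$ be a UCQ without comparison atoms. Then the perfect rewriting $Q$ is finite (the iteration stops), and for every tuple $t$ of values from $\Gamma$, $$t\in ans(q,\mathcal G,D)\iff Q_{cqa}(t)\ \text{is a cautious consequence of}\ D\cup P_{cqa}.$$ -/

import Mathlib

namespace CQA

universe u v w

/-! ### Relational schemas, databases, repairs -/

/-- A fact `r(t)` over relation names `R` with arities `ar` and values `Γ`.
A database is a (possibly infinite) set of facts. -/
structure DBFact {R : Type u} (ar : R → ℕ) (Γ : Type v) where
  rel : R
  args : Fin (ar rel) → Γ

/-- An inclusion dependency `∀ x [r₁(x₁) → ∃ y r₂(x₂)]`, in which no variable is repeated inside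
`x₁` or inside `x₂`. The `k` shared (universally quantified) variables stand at the positions
`left j` of `r₁` and `right j` of `r₂`; every other position of `r₂` carries its own
existentially quantified variable. -/
structure IND {R : Type u} (ar : R → ℕ) where
  lhs : R
  rhs : R
  k : ℕ
  left : Fin k ↪ Fin (ar lhs)
  right : Fin k ↪ Fin (ar rhs)

/-- A schema with exactly one key for each relation and a finite set of INDs.
(A relation without an explicit key has as key the set of all its positions.) -/
structure Schema {R : Type u} (ar : R → ℕ) where
  key : (r : R) → Finset (Fin (ar r))
  inds : Finset (IND ar)

section Databases

variable {R : Type u} {ar : R → ℕ} {Γ : Type v}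

/-- The set `π_R^d` of positions of the right-hand relation that carry universal variables. -/
def IND.rightPos (d : IND ar) : Finset (Fin (ar d.rhs)) :=
  Finset.univ.map d.right

/-- `d` is non-key-conflicting: `π_R^d` is not a proper superset of the key of the right-hand
relation. -/
def Schema.NKC (S : Schema ar) (d : IND ar) : Prop :=
  ¬ S.key d.rhs ⊂ d.rightPos

/-- Satisfaction of an inclusion dependency. -/
def IND.Holds (d : IND ar) (B : Set (DBFact ar Γ)) : Prop :=
  ∀ x : Fin (ar d.lhs) → Γ, (⟨d.lhs, x⟩ : DBFact ar Γ) ∈ B →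
    ∃ y : Fin (ar d.rhs) → Γ, (⟨d.rhs, y⟩ : DBFact ar Γ) ∈ B ∧
      ∀ j, y (d.right j) = x (d.left j)

/-- Satisfaction of the key dependencies: for each non-key position `i` of `r`, the denial
constraint `¬ [r(x₁) ∧ r(x₂) ∧ x₁ⁱ ≠ x₂ⁱ]`, where `x₁` and `x₂` coincide on the key. -/
def Schema.KeysHold (S : Schema ar) (B : Set (DBFact ar Γ)) : Prop :=
  ∀ (r : R) (i : Fin (ar r)), i ∉ S.key r → ∀ x₁ x₂ : Fin (ar r) → Γ,
    (∀ j ∈ S.key r, x₁ j = x₂ j) →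
    ¬ ((⟨r, x₁⟩ : DBFact ar Γ) ∈ B ∧ (⟨r, x₂⟩ : DBFact ar Γ) ∈ B ∧ x₁ i ≠ x₂ i)

/-- Consistency of a database with respect to the schema. -/
def Schema.Consistent (S : Schema ar) (B : Set (DBFact ar Γ)) : Prop :=
  S.KeysHold B ∧ ∀ d ∈ S.inds, d.Holds B

/-- `B` is a loosely-sound repair for `D`. -/
def IsLooselySoundRepair (S : Schema ar) (D B : Set (DBFact ar Γ)) : Prop :=
  S.Consistent B ∧
    ¬ ∃ B' : Set (DBFact ar Γ), S.Consistent B' ∧ B ∩ D ⊂ B' ∩ D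

end Databases

/-! ### Conjunctive queries without comparison atoms -/

/-- Terms: variables from `V` and constants from `Γ`. -/
inductive Term (V : Type u) (Γ : Type v) where
  | var (x : V) : Term V Γ
  | const (c : Γ) : Term V Γ

/-- Value of a term under a valuation of the variables. -/
def Term.eval {V : Type u} {Γ : Type v} (ν : V → Γ) : Term V Γ → Γ
  | .var x => ν x
  | .const c => c

/-- Application of a substitution to a term. -/
def Term.subst {V : Type u} {W : Type w} {Γ : Type v} (θ : V → Term W Γ) :
    Term V Γ → Term W Γ
  | .var x => θ x
  | .const c => .const c

/-- A query atom. An argument `none` is the anonymous variable `_`: every occurrence of it is an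
existentially quantified variable of its own. -/
structure QAtom {R : Type u} (ar : R → ℕ) (Γ : Type v) where
  rel : R
  args : Fin (ar rel) → Option (Term ℕ Γ)

/-- A conjunctive query with `n` output terms; the variables of the body that do not occur in the
head are existentially quantified. Equalities are expressed by repeating variables. -/
structure CQ {R : Type u} (ar : R → ℕ) (Γ : Type v) (n : ℕ) where
  head : Fin n → Term ℕ Γ
  body : Finset (QAtom ar Γ)

section Queries

variable {R : Type u} {ar : R → ℕ} {Γ : Type v} {n : ℕ}

/-- Every output variable occurs in an atom of the body. -/
def CQ.Safe (c : CQ ar Γ n) : Prop :=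
  ∀ k v, c.head k = .var v → ∃ a ∈ c.body, ∃ i, a.args i = some (.var v)

/-- The valuation `ν` maps the atom `a` onto some fact of `B`. -/
def QAtom.Sat (ν : ℕ → Γ) (B : Set (DBFact ar Γ)) (a : QAtom ar Γ) : Prop :=
  ∃ x : Fin (ar a.rel) → Γ, (⟨a.rel, x⟩ : DBFact ar Γ) ∈ B ∧
    ∀ i, ∀ τ ∈ a.args i, x i = τ.eval ν

/-- The answers to a conjunctive query over `B`. -/
def CQ.ans (c : CQ ar Γ n) (B : Set (DBFact ar Γ)) : Set (Fin n → Γ) :=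
  {t | ∃ ν : ℕ → Γ, (∀ k, t k = (c.head k).eval ν) ∧ ∀ a ∈ c.body, a.Sat ν B}

/-- The answers to a union of conjunctive queries over `B`. -/
def ucqAns (q : Finset (CQ ar Γ n)) (B : Set (DBFact ar Γ)) : Set (Fin n → Γ) :=
  {t | ∃ c ∈ q, t ∈ c.ans B}

/-- The consistent answers to `q` under the loosely-sound semantics. -/
def consistentAnswers (S : Schema ar) (D : Set (DBFact ar Γ)) (q : Finset (CQ ar Γ n)) :
    Set (Fin n → Γ) :=
  {t | ∀ B : Set (DBFact ar Γ), IsLooselySoundRepair S D B → t ∈ ucqAns q B}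

/-! ### Perfect rewriting with respect to inclusion dependencies -/

/-- `θ` unifies the argument lists `x` and `y`. An anonymous variable occurs nowhere else and
unifies with every term, so it imposes no condition. -/
def Unifies {m : ℕ} (θ : ℕ → Term ℕ Γ) (x y : Fin m → Option (Term ℕ Γ)) : Prop :=
  ∀ i, ∀ τ ∈ x i, ∀ τ' ∈ y i, τ.subst θ = τ'.subst θ

/-- `θ` is an (idempotent) most general unifier of `x` and `y`: it is a unifier, and every
unifier `η` factors through it, as `η = η ∘ θ`. -/
def IsMGU {m : ℕ} (θ : ℕ → Term ℕ Γ) (x y : Fin m → Option (Term ℕ Γ)) : Prop :=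
  Unifies θ x y ∧ ∀ η : ℕ → Term ℕ Γ, Unifies η x y → ∀ v, (θ v).subst η = η v

/-- Application of a substitution to an atom; anonymous variables are left alone. -/
def QAtom.subst (θ : ℕ → Term ℕ Γ) (a : QAtom ar Γ) : QAtom ar Γ :=
  ⟨a.rel, fun i => (a.args i).map (Term.subst θ)⟩

/-- The single atom that two atoms `r(x)` and `r(y)` become under their unifier `θ`. -/
def mergedAtom (r : R) (x y : Fin (ar r) → Option (Term ℕ Γ)) (θ : ℕ → Term ℕ Γ) :
    QAtom ar Γ :=
  QAtom.subst θ ⟨r, fun i => (x i).or (y i)⟩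

open Classical in
/-- Step (1): two distinct atoms of `c` that unify are replaced by their unifying atom, and the
most general unifier is applied to the whole query. -/
def CQ.Reduces (c c' : CQ ar Γ n) : Prop :=
  ∃ (r : R) (x y : Fin (ar r) → Option (Term ℕ Γ)) (θ : ℕ → Term ℕ Γ),
    (⟨r, x⟩ : QAtom ar Γ) ∈ c.body ∧ (⟨r, y⟩ : QAtom ar Γ) ∈ c.body ∧ x ≠ y ∧
    IsMGU θ x y ∧
    c'.head = (fun k => (c.head k).subst θ) ∧
    c'.body = insert (mergedAtom r x y θ)
      (((c.body.erase ⟨r, x⟩).erase ⟨r, y⟩).image (QAtom.subst θ))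

/-- The variable `v` is unbound in `c`: it is not an output variable, and it has exactly one
occurrence in the body. -/
def CQ.Unbound (c : CQ ar Γ n) (v : ℕ) : Prop :=
  (∀ k, c.head k ≠ .var v) ∧
    ∃! o : (a : QAtom ar Γ) × Fin (ar a.rel), o.1 ∈ c.body ∧ o.1.args o.2 = some (.var v)

/-- `d` is applicable to the atom `r₂(x)` of `c`, where `r₂` is the right-hand relation of `d`:
the positions that `d` does not propagate hold only anonymous or unbound variables. -/
def IND.Applicable (d : IND ar) (c : CQ ar Γ n) (x : Fin (ar d.rhs) → Option (Term ℕ Γ)) :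
    Prop :=
  ∀ i, i ∉ d.rightPos → x i = none ∨ ∃ v, x i = some (.var v) ∧ c.Unbound v

open Classical in
/-- The atom of the left-hand relation that `d`, read from right to left, yields from `r₂(x)`:
position `left j` receives the term at `right j`, every other position an anonymous variable. -/
noncomputable def IND.rewriteAtom (d : IND ar) (x : Fin (ar d.rhs) → Option (Term ℕ Γ)) :
    QAtom ar Γ :=
  ⟨d.lhs, fun i => if h : ∃ j, d.left j = i then x (d.right h.choose) else none⟩

open Classical in
/-- Step (2): an atom of `c` to which `d` is applicable is rewritten by `d` from right to left. -/
def CQ.RewritesBy (d : IND ar) (c c' : CQ ar Γ n) : Prop :=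
  ∃ x : Fin (ar d.rhs) → Option (Term ℕ Γ),
    (⟨d.rhs, x⟩ : QAtom ar Γ) ∈ c.body ∧ d.Applicable c x ∧
    c'.head = c.head ∧
    c'.body = insert (d.rewriteAtom x) (c.body.erase ⟨d.rhs, x⟩)

/-- One iteration of the rewriting algorithm: add all results of steps (1) and (2). -/
def rewritingStep (S : Schema ar) (Q : Set (CQ ar Γ n)) : Set (CQ ar Γ n) :=
  Q ∪ {c' | ∃ c ∈ Q, c.Reduces c'} ∪ {c' | ∃ c ∈ Q, ∃ d ∈ S.inds, CQ.RewritesBy d c c'}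

/-- The perfect rewriting of `q`: start with the disjuncts of `q` and iterate until nothing new
is added. -/
def perfectRewriting (S : Schema ar) (q : Finset (CQ ar Γ n)) : Set (CQ ar Γ n) :=
  ⋃ m : ℕ, (rewritingStep S)^[m] (q : Set (CQ ar Γ n))

end Queries

/-! ### Answer set programs: ground semantics -/

/-- A ground disjunctive rule `a₁ ∨ ⋯ ∨ aₖ :- b₁, …, bₗ, not c₁, …, not cₘ`. -/
structure GroundRule (A : Type u) where
  head : List A
  pos : List A
  neg : List A

section GroundSemantics

variable {A : Type u}

/-- `M` satisfies the ground rule `ρ`. -/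
def GroundRule.Sat (M : Set A) (ρ : GroundRule A) : Prop :=
  (∀ a ∈ ρ.pos, a ∈ M) → (∀ a ∈ ρ.neg, a ∉ M) → ∃ a ∈ ρ.head, a ∈ M

/-- `M` is a model of the ground program `P`. -/
def IsModel (P : Set (GroundRule A)) (M : Set A) : Prop :=
  ∀ ρ ∈ P, ρ.Sat M

/-- The Gelfond-Lifschitz reduct of `P` with respect to `M`. -/
def reduct (P : Set (GroundRule A)) (M : Set A) : Set (GroundRule A) :=
  {ρ' | ∃ ρ ∈ P, (∀ a ∈ ρ.neg, a ∉ M) ∧ ρ' = ⟨ρ.head, ρ.pos, []⟩}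

/-- `M` is an answer set of `P`: a minimal model of the reduct of `P` with respect to `M`. -/
def IsAnswerSet (P : Set (GroundRule A)) (M : Set A) : Prop :=
  IsModel (reduct P M) M ∧ ∀ N : Set A, N ⊆ M → IsModel (reduct P M) N → N = M

end GroundSemantics

/-! ### The program with variables -/

/-- Atoms `g(x)`, `gᶜ(x)` (deleted), `gʳ(x)` (repaired) for each relation `g`, and atoms of the
`n`-ary query predicate, with arguments from `T`. -/
inductive AspAtom {R : Type u} (ar : R → ℕ) (n : ℕ) (T : Type v) where
  | base (r : R) (x : Fin (ar r) → T) : AspAtom ar n T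
  | del (r : R) (x : Fin (ar r) → T) : AspAtom ar n T
  | rep (r : R) (x : Fin (ar r) → T) : AspAtom ar n T
  | query (x : Fin n → T) : AspAtom ar n T

/-- Apply `f` to each argument of an atom. -/
def AspAtom.map {R : Type u} {ar : R → ℕ} {n : ℕ} {T : Type v} {T' : Type w} (f : T → T') :
    AspAtom ar n T → AspAtom ar n T'
  | .base r x => .base r (f ∘ x)
  | .del r x => .del r (f ∘ x)
  | .rep r x => .rep r (f ∘ x)
  | .query x => .query (f ∘ x)

/-- Variables of programs: named variables, and one variable for each position of each query
atom, used to name the anonymous variables apart. -/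
abbrev PVar {R : Type u} (ar : R → ℕ) (Γ : Type v) := ℕ ⊕ (QAtom ar Γ × ℕ)

/-- A disjunctive rule with variables; `neq` lists the built-in atoms `τ ≠ τ'` of the body. -/
structure AspRule {R : Type u} (ar : R → ℕ) (Γ : Type v) (n : ℕ) where
  head : List (AspAtom ar n (Term (PVar ar Γ) Γ))
  pos : List (AspAtom ar n (Term (PVar ar Γ) Γ))
  neg : List (AspAtom ar n (Term (PVar ar Γ) Γ))
  neq : List (Term (PVar ar Γ) Γ × Term (PVar ar Γ) Γ)

section Programs

variable {R : Type u} {ar : R → ℕ} {Γ : Type v} {n : ℕ}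

/-- The instance of a rule under a valuation of its variables. -/
def AspRule.ground (ν : PVar ar Γ → Γ) (ρ : AspRule ar Γ n) : GroundRule (AspAtom ar n Γ) :=
  ⟨ρ.head.map (AspAtom.map (Term.eval ν)), ρ.pos.map (AspAtom.map (Term.eval ν)),
    ρ.neg.map (AspAtom.map (Term.eval ν))⟩

/-- The ground instances, over the domain `Γ`, of the rules of a program whose built-in atoms are
true. -/
def grounding (P : Set (AspRule ar Γ n)) : Set (GroundRule (AspAtom ar n Γ)) :=
  {g | ∃ ρ ∈ P, ∃ ν : PVar ar Γ → Γ,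
    (∀ e ∈ ρ.neq, e.1.eval ν ≠ e.2.eval ν) ∧ g = ρ.ground ν}

/-- The ground atom `a` is a cautious consequence of `P`: it belongs to every answer set. -/
def IsCautiousConsequence (P : Set (AspRule ar Γ n)) (a : AspAtom ar n Γ) : Prop :=
  ∀ M : Set (AspAtom ar n Γ), IsAnswerSet (grounding P) M → a ∈ M

/-- The facts of `D`, as rules with an empty body. -/
def factRules (n : ℕ) (D : Set (DBFact ar Γ)) : Set (AspRule ar Γ n) :=
  {ρ | ∃ f ∈ D, ρ = ⟨[.base f.rel (fun i => .const (f.args i))], [], [], []⟩}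

/-- The first variable sequence of the key dependency of `r`. -/
def keyVars₁ (r : R) (i : Fin (ar r)) : Term (PVar ar Γ) Γ :=
  .var (.inl i)

/-- The second variable sequence of the key dependency of `r`: it coincides with the first on
the key and has new variables elsewhere. -/
def keyVars₂ (S : Schema ar) (r : R) (i : Fin (ar r)) : Term (PVar ar Γ) Γ :=
  if i ∈ S.key r then .var (.inl i) else .var (.inl (ar r + i))

/-- For each relation `r` and each non-key position `i`, the rule
`rᶜ(x₁) ∨ rᶜ(x₂) :- r(x₁), r(x₂), x₁ⁱ ≠ x₂ⁱ.` -/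
def keyRules (S : Schema ar) : Set (AspRule ar Γ n) :=
  {ρ | ∃ (r : R) (i : Fin (ar r)), i ∉ S.key r ∧
    ρ = ⟨[.del r (keyVars₁ r), .del r (keyVars₂ S r)],
      [.base r (keyVars₁ r), .base r (keyVars₂ S r)], [],
      [(keyVars₁ r i, keyVars₂ S r i)]⟩}

/-- For each relation `r`, the rule `rʳ(x) :- r(x), not rᶜ(x).` -/
def repairRules : Set (AspRule ar Γ n) :=
  {ρ | ∃ r : R, ρ = ⟨[.rep r (keyVars₁ r)], [.base r (keyVars₁ r)], [.del r (keyVars₁ r)], []⟩}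

/-- The atom `gʳ(y)` that replaces the query atom `g(y)`. -/
def QAtom.repaired (n : ℕ) (a : QAtom ar Γ) : AspAtom ar n (Term (PVar ar Γ) Γ) :=
  .rep a.rel (fun i => match a.args i with
    | some τ => τ.subst (fun v => .var (.inl v))
    | none => .var (.inr (a, i)))

/-- The conjunctive query `c` as a rule for the query predicate over the repaired relations. -/
noncomputable def CQ.toRule (c : CQ ar Γ n) : AspRule ar Γ n :=
  ⟨[.query (fun k => (c.head k).subst (fun v => .var (.inl v)))],
    c.body.toList.map (QAtom.repaired n), [], []⟩

/-- The query `Q_cqa`: the rules of the perfect rewriting of `q`, renamed to the repaired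
relations. -/
def queryRules (S : Schema ar) (q : Finset (CQ ar Γ n)) : Set (AspRule ar Γ n) :=
  CQ.toRule '' perfectRewriting S q

/-- The program `P_cqa` for the loosely-sound semantics, together with the rules of `Q_cqa`. -/
def cqaProgram (S : Schema ar) (q : Finset (CQ ar Γ n)) : Set (AspRule ar Γ n) :=
  keyRules S ∪ repairRules ∪ queryRules S q

end Programs

end CQA

/-!
Extend a finite key-consistent database `K` by the chase: whenever an IND demands a fact, insert
one with fresh values at the positions that the IND does not propagate. Under NKC the keys survive:
either some key position carries a fresh value, or the key is exactly the set of propagated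
positions, and then a fact with the same key would already have satisfied the IND. So loosely-sound
repairs meet `D` exactly in the maximal key-consistent subsets of `D`.

The insertion of a fact creates no new answer to the perfect rewriting. If a match of a query uses
the new fact, step (1) merges all atoms that are mapped to it into a single one; its variables at
fresh positions are then unbound, so step (2) replaces it by an atom that matches the fact which
triggered the insertion. Hence `t` is an answer in every repair iff the rewriting yields `t` over
every maximal key-consistent subset `K` of `D`, and these `K` are also what the answer sets of the
program encode, the deleted facts being `D \ K`.
-/

namespace CQA

variable {R : Type*} {ar : R → ℕ} {Γ : Type*} {n : ℕ}

section Unification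

/-! ### Unification -/

theorem Term.eval_subst {V W : Type*} (ν : W → Γ) (θ : V → Term W Γ) (τ : Term V Γ) :
    (τ.subst θ).eval ν = τ.eval (fun v => (θ v).eval ν) := by
  cases τ <;> rfl

theorem Term.subst_const {V W : Type*} (ν : V → Γ) (τ : Term V Γ) :
    τ.subst (fun v => (.const (ν v) : Term W Γ)) = .const (τ.eval ν) := by
  cases τ <;> rfl

theorem Term.subst_update_of_ne {V W : Type*} [DecidableEq V] {θ : V → Term W Γ} {v : V}
    {σ : Term W Γ} {τ : Term V Γ} (h : τ ≠ .var v) :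
    τ.subst (Function.update θ v σ) = τ.subst θ := by
  cases τ with
  | var w => exact Function.update_of_ne (fun e => h (congrArg Term.var e)) σ θ
  | const c => rfl

variable {m : ℕ} {x y : Fin m → Option (Term ℕ Γ)} {θ : ℕ → Term ℕ Γ} {ν : ℕ → Γ}
  {z : Fin m → Γ}

/-- The valuation `ν` maps the argument list `x` to the tuple `z`. An anonymous variable matches
every value. -/
def Matches (ν : ℕ → Γ) (x : Fin m → Option (Term ℕ Γ)) (z : Fin m → Γ) : Prop :=
  ∀ i, ∀ τ ∈ x i, z i = τ.eval ν

theorem unifies_const_iff :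
    Unifies (fun v => .const (ν v)) x y ↔
      ∀ i, ∀ τ ∈ x i, ∀ τ' ∈ y i, τ.eval ν = τ'.eval ν := by
  simp only [Unifies, Term.subst_const, Term.const.injEq]

theorem Matches.unifies (hx : Matches ν x z) (hy : Matches ν y z) :
    Unifies (fun v => .const (ν v)) x y :=
  unifies_const_iff.2 fun i τ hτ τ' hτ' => (hx i τ hτ).symm.trans (hy i τ' hτ')

theorem IsMGU.eval_eq (h : IsMGU θ x y) (hν : Unifies (fun v => .const (ν v)) x y) :
    (fun v => (θ v).eval ν) = ν :=
  funext fun v => Term.const.inj ((Term.subst_const ν (θ v)).symm.trans (h.2 _ hν v))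

/-- Two terms are equivalent if every unifier of `x` and `y` identifies them. Picking one term from
each class is how a most general unifier is found. -/
def unifierSetoid (x y : Fin m → Option (Term ℕ Γ)) : Setoid (Term ℕ Γ) where
  r τ τ' := ∀ η, Unifies η x y → τ.subst η = τ'.subst η
  iseqv :=
    ⟨fun _ _ _ => rfl, fun h η hη => (h η hη).symm, fun h h' η hη => (h η hη).trans (h' η hη)⟩

theorem Unifies.exists_isMGU {η₀ : ℕ → Term ℕ Γ} (h₀ : Unifies η₀ x y) : ∃ θ, IsMGU θ x y := by
  let cls : Term ℕ Γ → Quotient (unifierSetoid x y) := Quotient.mk _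
  -- Each class contains at most one constant, which has to be its representative.
  have exists_rep : ∀ a, ∃ τ, cls τ = a ∧ ∀ c, cls (.const c) = a → τ = .const c := by
    intro a
    by_cases ha : ∃ c, cls (.const c) = a
    · obtain ⟨c, rfl⟩ := ha
      exact ⟨.const c, rfl, fun c' hc' => (Quotient.exact hc' η₀ h₀).symm⟩
    · exact ⟨a.out, a.out_eq, fun c hc => (ha ⟨c, hc⟩).elim⟩
  choose rep cls_rep rep_const using exists_rep
  let θ : ℕ → Term ℕ Γ := fun v => rep (cls (.var v))
  have subst_eq_rep : ∀ τ, τ.subst θ = rep (cls τ)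
    | .var _ => rfl
    | .const c => (rep_const _ c rfl).symm
  refine ⟨θ, fun i τ hτ τ' hτ' => ?_, fun η hη v => Quotient.exact (cls_rep _) η hη⟩
  have same_class : cls τ = cls τ' := Quotient.sound fun η hη => hη i τ hτ τ' hτ'
  rw [subst_eq_rep, subst_eq_rep, same_class]

theorem IsMGU.const_mem (h : IsMGU θ x y) {T : Set (Term ℕ Γ)} (hx : ∀ i, ∀ τ ∈ x i, τ ∈ T)
    (hy : ∀ i, ∀ τ ∈ y i, τ ∈ T) {v : ℕ} {c : Γ} (hv : θ v = .const c) : .const c ∈ T := by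
  classical
  by_contra hc
  -- Replacing the constant `c`, which `T` does not mention, by a variable leaves `θ` a unifier.
  let g : Term ℕ Γ → Term ℕ Γ := fun τ => if τ = .const c then .var 0 else τ
  have subst_g : ∀ τ ∈ T, τ.subst (fun u => g (θ u)) = g (τ.subst θ) := by
    rintro (u | e) hτ
    · rfl
    · exact (if_neg fun he : Term.const e = .const c => hc (he ▸ hτ)).symm
  have unifies_g : Unifies (fun u => g (θ u)) x y := fun i τ hτ τ' hτ' => by
    rw [subst_g τ (hx i τ hτ), subst_g τ' (hy i τ' hτ'), h.1 i τ hτ τ' hτ']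
  have := h.2 _ unifies_g v
  simp [hv, Term.subst, g] at this

theorem IsMGU.var_mem (h : IsMGU θ x y) {T : Set (Term ℕ Γ)} (hx : ∀ i, ∀ τ ∈ x i, τ ∈ T)
    (hy : ∀ i, ∀ τ ∈ y i, τ ∈ T) {v w : ℕ} (hv : θ v = .var w) (hvw : v ≠ w) : .var w ∈ T := by
  by_contra hw
  -- Redefining `θ` at the variable `w`, which `T` does not mention, leaves it a unifier.
  let η := Function.update θ w (.var (w + 1))
  have subst_η : ∀ τ ∈ T, τ.subst η = τ.subst θ := fun τ hτ =>
    Term.subst_update_of_ne fun e => hw (e ▸ hτ)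
  have unifies_η : Unifies η x y := fun i τ hτ τ' hτ' => by
    rw [subst_η τ (hx i τ hτ), subst_η τ' (hy i τ' hτ'), h.1 i τ hτ τ' hτ']
  have := h.2 η unifies_η v
  simp [hv, hvw, Term.subst, η] at this

theorem IsMGU.subst_mem (h : IsMGU θ x y) {T : Set (Term ℕ Γ)} (hx : ∀ i, ∀ τ ∈ x i, τ ∈ T)
    (hy : ∀ i, ∀ τ ∈ y i, τ ∈ T) : ∀ τ ∈ T, τ.subst θ ∈ T
  | .const _, hτ => hτ
  | .var v, hτ => by
    change θ v ∈ T
    cases hv : θ v with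
    | const c => exact h.const_mem hx hy hv
    | var w =>
      by_cases hvw : v = w
      · exact hvw ▸ hτ
      · exact h.var_mem hx hy hv hvw

theorem matches_subst_iff :
    Matches ν (fun i => (x i).map (Term.subst θ)) z ↔ Matches (fun v => (θ v).eval ν) x z :=
  forall_congr' fun _ => by
    simp only [Option.mem_map, forall_exists_index, and_imp, forall_apply_eq_imp_iff₂,
      Term.eval_subst]

theorem QAtom.sat_subst_iff {a : QAtom ar Γ} {B : Set (DBFact ar Γ)} :
    (a.subst θ).Sat ν B ↔ a.Sat (fun v => (θ v).eval ν) B :=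
  exists_congr fun _ => and_congr Iff.rfl matches_subst_iff

theorem Unifies.matches_mergedAtom_iff {r : R} {x y : Fin (ar r) → Option (Term ℕ Γ)}
    (h : Unifies θ x y) {z : Fin (ar r) → Γ} :
    Matches ν (mergedAtom r x y θ).args z ↔
      Matches (fun v => (θ v).eval ν) x z ∧ Matches (fun v => (θ v).eval ν) y z := by
  refine matches_subst_iff.trans ⟨fun hz => ⟨fun i τ hτ => ?_, fun i τ hτ => ?_⟩, ?_⟩
  · exact hz i τ (Option.or_eq_some_iff.2 (.inl hτ))
  · cases hxi : x i with
    | none => exact hz i τ (Option.or_eq_some_iff.2 (.inr ⟨hxi, hτ⟩))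
    | some σ =>
      rw [hz i σ (Option.or_eq_some_iff.2 (.inl hxi)), ← Term.eval_subst, ← Term.eval_subst,
        h i σ hxi τ hτ]
  · rintro ⟨hx, hy⟩ i τ hτ
    rcases Option.or_eq_some_iff.1 hτ with hτ | ⟨-, hτ⟩
    exacts [hx i τ hτ, hy i τ hτ]

end Unification

section RewritingSteps

/-! ### The two rewriting steps -/

variable {S : Schema ar} {Q : Set (CQ ar Γ n)} {c c' : CQ ar Γ n} {d : IND ar}
  {B : Set (DBFact ar Γ)} {ν : ℕ → Γ} {t : Fin n → Γ}

open Classical in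
/-- The query that step (1) of the rewriting produces from `c` by merging the atoms `r(x)` and
`r(y)` under the unifier `θ`. -/
noncomputable def CQ.merge (c : CQ ar Γ n) (r : R) (x y : Fin (ar r) → Option (Term ℕ Γ))
    (θ : ℕ → Term ℕ Γ) : CQ ar Γ n :=
  ⟨fun k => (c.head k).subst θ, insert (mergedAtom r x y θ)
    (((c.body.erase ⟨r, x⟩).erase ⟨r, y⟩).image (QAtom.subst θ))⟩

open Classical in
/-- The query that step (2) of the rewriting produces from `c` by reading `d` from right to left
on the atom with arguments `u`. -/
noncomputable def CQ.rewrite (c : CQ ar Γ n) (d : IND ar)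
    (u : Fin (ar d.rhs) → Option (Term ℕ Γ)) : CQ ar Γ n :=
  ⟨c.head, insert (d.rewriteAtom u) (c.body.erase ⟨d.rhs, u⟩)⟩

theorem CQ.reduces_iff : c.Reduces c' ↔
    ∃ (r : R) (x y : Fin (ar r) → Option (Term ℕ Γ)) (θ : ℕ → Term ℕ Γ),
      (⟨r, x⟩ : QAtom ar Γ) ∈ c.body ∧ (⟨r, y⟩ : QAtom ar Γ) ∈ c.body ∧ x ≠ y ∧
      IsMGU θ x y ∧ c' = c.merge r x y θ := by
  cases c'
  simp only [CQ.Reduces, CQ.merge, CQ.mk.injEq]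

theorem CQ.rewritesBy_iff : CQ.RewritesBy d c c' ↔
    ∃ u : Fin (ar d.rhs) → Option (Term ℕ Γ), (⟨d.rhs, u⟩ : QAtom ar Γ) ∈ c.body ∧
      d.Applicable c u ∧ c' = c.rewrite d u := by
  cases c'
  simp only [CQ.RewritesBy, CQ.rewrite, CQ.mk.injEq]

theorem CQ.Reduces.mem_of_rewritingStep_subset (h : c.Reduces c') (hQ : rewritingStep S Q ⊆ Q)
    (hc : c ∈ Q) : c' ∈ Q :=
  hQ (.inl (.inr ⟨c, hc, h⟩))

theorem CQ.RewritesBy.mem_of_rewritingStep_subset (h : CQ.RewritesBy d c c')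
    (hQ : rewritingStep S Q ⊆ Q) (hd : d ∈ S.inds) (hc : c ∈ Q) : c' ∈ Q :=
  hQ (.inr ⟨c, hc, d, hd, h⟩)

theorem subset_perfectRewriting (S : Schema ar) (q : Finset (CQ ar Γ n)) :
    (q : Set (CQ ar Γ n)) ⊆ perfectRewriting S q :=
  fun _ hc => Set.mem_iUnion.2 ⟨0, hc⟩

theorem rewritingStep_perfectRewriting_subset (S : Schema ar) (q : Finset (CQ ar Γ n)) :
    rewritingStep S (perfectRewriting S q) ⊆ perfectRewriting S q := by
  have succ : ∀ {m c}, c ∈ rewritingStep S ((rewritingStep S)^[m] (q : Set (CQ ar Γ n))) →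
      c ∈ perfectRewriting S q := fun {m c} hc =>
    Set.mem_iUnion.2 ⟨m + 1, by rwa [Function.iterate_succ_apply']⟩
  rintro c' ((hc | ⟨c, hc, h⟩) | ⟨c, hc, h⟩)
  · exact hc
  · obtain ⟨m, hm⟩ := Set.mem_iUnion.1 hc
    exact succ (.inl (.inr ⟨c, hm, h⟩))
  · obtain ⟨m, hm⟩ := Set.mem_iUnion.1 hc
    exact succ (.inr ⟨c, hm, h⟩)

theorem perfectRewriting_subset {q : Finset (CQ ar Γ n)} (hq : (q : Set (CQ ar Γ n)) ⊆ Q)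
    (hred : ∀ c ∈ Q, ∀ c', c.Reduces c' → c' ∈ Q)
    (hrew : ∀ d ∈ S.inds, ∀ c ∈ Q, ∀ c', CQ.RewritesBy d c c' → c' ∈ Q) :
    perfectRewriting S q ⊆ Q := by
  refine Set.iUnion_subset fun m => ?_
  induction m with
  | zero => exact hq
  | succ m ih =>
    rw [Function.iterate_succ_apply']
    rintro c' ((hc | ⟨c, hc, h⟩) | ⟨c, hc, d, hd, h⟩)
    exacts [ih hc, hred c (ih hc) c' h, hrew d hd c (ih hc) c' h]

theorem IND.mem_rightPos {i : Fin (ar d.rhs)} : i ∈ d.rightPos ↔ ∃ j, d.right j = i := by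
  simp only [IND.rightPos, Finset.mem_map, Finset.mem_univ, true_and]

theorem IND.rewriteAtom_args_eq_some_iff {u : Fin (ar d.rhs) → Option (Term ℕ Γ)}
    {i : Fin (ar d.lhs)} {τ : Term ℕ Γ} :
    (d.rewriteAtom u).args i = some τ ↔ ∃ j, d.left j = i ∧ u (d.right j) = some τ := by
  by_cases hi : ∃ j, d.left j = i
  · have args_eq : (d.rewriteAtom u).args i = u (d.right hi.choose) := dif_pos hi
    rw [args_eq]
    refine ⟨fun h => ⟨_, hi.choose_spec, h⟩, fun ⟨j, hj, h⟩ => ?_⟩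
    rwa [d.left.injective (hi.choose_spec.trans hj.symm)]
  · have args_eq : (d.rewriteAtom u).args i = none := dif_neg hi
    rw [args_eq]
    exact ⟨nofun, fun ⟨j, hj, _⟩ => (hi ⟨j, hj⟩).elim⟩

theorem IND.matches_rewriteAtom_iff {u : Fin (ar d.rhs) → Option (Term ℕ Γ)}
    {x : Fin (ar d.lhs) → Γ} :
    Matches ν (d.rewriteAtom u).args x ↔
      ∀ j, ∀ τ ∈ u (d.right j), x (d.left j) = τ.eval ν :=
  ⟨fun h j τ hτ => h _ τ (IND.rewriteAtom_args_eq_some_iff.2 ⟨j, rfl, hτ⟩), fun h i τ hτ => by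
    obtain ⟨j, rfl, hj⟩ := IND.rewriteAtom_args_eq_some_iff.1 hτ
    exact h j τ hj⟩

end RewritingSteps

section Finiteness

/-! ### Finiteness of the perfect rewriting -/

/-- The query atoms over the relations `P` with terms from `T`. -/
def QAtom.over (P : Set R) (T : Set (Term ℕ Γ)) : Set (QAtom ar Γ) :=
  {a | a.rel ∈ P ∧ ∀ i, ∀ τ ∈ a.args i, τ ∈ T}

/-- The conjunctive queries over the relations `P` with terms from `T`. For finite `P` and `T` there
are finitely many of them, and the rewriting steps do not lead out of them. -/
def CQ.over (P : Set R) (T : Set (Term ℕ Γ)) : Set (CQ ar Γ n) :=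
  {c | (∀ k, c.head k ∈ T) ∧ ∀ a ∈ c.body, a ∈ QAtom.over P T}

variable {P P' : Set R} {T : Set (Term ℕ Γ)} {c c' : CQ ar Γ n}

theorem QAtom.finite_over (hP : P.Finite) (hT : T.Finite) :
    (QAtom.over P T : Set (QAtom ar Γ)).Finite := by
  have finite_args (r : R) :
      (Set.univ.pi fun _ : Fin (ar r) => insert none (some '' T)).Finite :=
    Set.Finite.pi fun _ => (hT.image some).insert none
  refine (hP.biUnion fun r _ => (finite_args r).image (QAtom.mk r)).subset ?_
  rintro ⟨r, x⟩ ⟨hr, hx⟩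
  refine Set.mem_biUnion hr ⟨x, fun i _ => ?_, rfl⟩
  cases h : x i with
  | none => exact .inl rfl
  | some τ => exact .inr ⟨τ, hx i τ h, rfl⟩

theorem CQ.finite_over (hP : P.Finite) (hT : T.Finite) :
    (CQ.over P T : Set (CQ ar Γ n)).Finite := by
  have finite_heads : (Set.univ.pi fun _ : Fin n => T).Finite := Set.Finite.pi fun _ => hT
  have finite_atoms := QAtom.finite_over (ar := ar) hP hT
  refine (finite_heads.image2 CQ.mk finite_atoms.toFinset.powerset.finite_toSet).subset ?_
  rintro ⟨head, body⟩ ⟨hhead, hbody⟩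
  refine ⟨head, fun k _ => hhead k, body, ?_, rfl⟩
  exact Finset.mem_powerset.2 fun a ha => finite_atoms.mem_toFinset.2 (hbody a ha)

theorem CQ.over_mono (h : P ⊆ P') : (CQ.over P T : Set (CQ ar Γ n)) ⊆ CQ.over P' T :=
  fun _ hc => ⟨hc.1, fun a ha => ⟨h (hc.2 a ha).1, (hc.2 a ha).2⟩⟩

theorem CQ.exists_finite_over (q : Finset (CQ ar Γ n)) :
    ∃ (P : Set R) (T : Set (Term ℕ Γ)), P.Finite ∧ T.Finite ∧
      (q : Set (CQ ar Γ n)) ⊆ CQ.over P T := by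
  refine ⟨⋃ c ∈ q, ⋃ a ∈ c.body, {a.rel},
    ⋃ c ∈ q, (Set.range c.head ∪ ⋃ a ∈ c.body, some ⁻¹' Set.range a.args), ?_, ?_, ?_⟩
  · exact q.finite_toSet.biUnion fun c _ => c.body.finite_toSet.biUnion fun a _ =>
      Set.finite_singleton _
  · exact q.finite_toSet.biUnion fun c _ => (Set.finite_range _).union
      (c.body.finite_toSet.biUnion fun a _ =>
        (Set.finite_range _).preimage (Option.some_injective _).injOn)
  · refine fun c hc => ⟨fun k => ?_, fun a ha => ⟨?_, fun i τ hτ => ?_⟩⟩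
    · exact Set.mem_biUnion hc (.inl ⟨k, rfl⟩)
    · exact Set.mem_biUnion hc (Set.mem_biUnion ha rfl)
    · exact Set.mem_biUnion hc (.inr (Set.mem_biUnion ha ⟨i, hτ⟩))

theorem QAtom.subst_mem_over {θ : ℕ → Term ℕ Γ} (hθ : ∀ τ ∈ T, τ.subst θ ∈ T)
    {a : QAtom ar Γ} (ha : a ∈ QAtom.over P T) : a.subst θ ∈ QAtom.over P T := by
  refine ⟨ha.1, fun i τ hτ => ?_⟩
  obtain ⟨σ, hσ, rfl⟩ := Option.mem_map.1 hτ
  exact hθ σ (ha.2 i σ hσ)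

theorem CQ.Reduces.mem_over (h : c.Reduces c') (hc : c ∈ CQ.over P T) : c' ∈ CQ.over P T := by
  classical
  obtain ⟨r, x, y, θ, hx, hy, -, hθ, rfl⟩ := CQ.reduces_iff.1 h
  have hT : ∀ τ ∈ T, τ.subst θ ∈ T := hθ.subst_mem (hc.2 _ hx).2 (hc.2 _ hy).2
  refine ⟨fun k => hT _ (hc.1 k), fun a ha => ?_⟩
  rcases Finset.mem_insert.1 ha with rfl | ha
  · refine QAtom.subst_mem_over hT ⟨(hc.2 _ hx).1, fun i τ hτ => ?_⟩
    rcases Option.or_eq_some_iff.1 hτ with hτ | ⟨-, hτ⟩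
    exacts [(hc.2 _ hx).2 i τ hτ, (hc.2 _ hy).2 i τ hτ]
  · obtain ⟨b, hb, rfl⟩ := Finset.mem_image.1 ha
    exact QAtom.subst_mem_over hT (hc.2 b (Finset.mem_of_mem_erase (Finset.mem_of_mem_erase hb)))

theorem CQ.RewritesBy.mem_over {d : IND ar} (h : CQ.RewritesBy d c c') (hd : d.lhs ∈ P)
    (hc : c ∈ CQ.over P T) : c' ∈ CQ.over P T := by
  classical
  obtain ⟨u, hu, -, rfl⟩ := CQ.rewritesBy_iff.1 h
  refine ⟨hc.1, fun a ha => ?_⟩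
  rcases Finset.mem_insert.1 ha with rfl | ha
  · refine ⟨hd, fun i τ hτ => ?_⟩
    obtain ⟨j, -, hj⟩ := IND.rewriteAtom_args_eq_some_iff.1 hτ
    exact (hc.2 _ hu).2 _ τ hj
  · exact hc.2 a (Finset.mem_of_mem_erase ha)

theorem perfectRewriting_finite (S : Schema ar) (q : Finset (CQ ar Γ n)) :
    (perfectRewriting S q).Finite := by
  obtain ⟨P, T, hP, hT, hq⟩ := CQ.exists_finite_over q
  refine (CQ.finite_over (hP.union (S.inds.finite_toSet.image IND.lhs)) hT).subset ?_
  exact perfectRewriting_subset (hq.trans (CQ.over_mono Set.subset_union_left))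
    (fun _ hc _ h => h.mem_over hc)
    fun _ hd _ hc _ h => h.mem_over (.inr (Set.mem_image_of_mem _ hd)) hc

end Finiteness

section Soundness

/-! ### Soundness of the perfect rewriting -/

variable {S : Schema ar} {q : Finset (CQ ar Γ n)} {Q : Set (CQ ar Γ n)} {c c' : CQ ar Γ n}
  {d : IND ar} {B B' : Set (DBFact ar Γ)} {ν : ℕ → Γ} {t : Fin n → Γ} {r : R}
  {x y : Fin (ar r) → Option (Term ℕ Γ)} {z : Fin (ar r) → Γ} {θ : ℕ → Term ℕ Γ}

/-- The valuation `ν` witnesses that `t` is an answer to `c` over `B`. -/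
def CQ.IsWitness (c : CQ ar Γ n) (ν : ℕ → Γ) (t : Fin n → Γ) (B : Set (DBFact ar Γ)) : Prop :=
  (∀ k, t k = (c.head k).eval ν) ∧ ∀ a ∈ c.body, a.Sat ν B

/-- The answers over `B` to a possibly infinite union of conjunctive queries. -/
def answers (Q : Set (CQ ar Γ n)) (B : Set (DBFact ar Γ)) : Set (Fin n → Γ) :=
  {t | ∃ c ∈ Q, t ∈ c.ans B}

theorem QAtom.Sat.mono (h : B ⊆ B') {a : QAtom ar Γ} (ha : a.Sat ν B) : a.Sat ν B' :=
  ha.imp fun _ hx => ⟨h hx.1, hx.2⟩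

theorem CQ.ans_mono (h : B ⊆ B') : c.ans B ⊆ c.ans B' :=
  fun _ ⟨ν, hhead, hbody⟩ => ⟨ν, hhead, fun a ha => (hbody a ha).mono h⟩

theorem answers_mono (h : B ⊆ B') : answers Q B ⊆ answers Q B' :=
  fun _ ⟨c, hc, ht⟩ => ⟨c, hc, CQ.ans_mono h ht⟩

theorem CQ.IsWitness.of_merge (hθ : Unifies θ x y) (h : (c.merge r x y θ).IsWitness ν t B) :
    c.IsWitness (fun v => (θ v).eval ν) t B := by
  classical
  refine ⟨fun k => (h.1 k).trans (Term.eval_subst ν θ _), fun a ha => ?_⟩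
  obtain ⟨z, hz, hmerged⟩ := h.2 (mergedAtom r x y θ) (Finset.mem_insert_self _ _)
  obtain ⟨hzx, hzy⟩ := hθ.matches_mergedAtom_iff.1 hmerged
  by_cases hax : a = ⟨r, x⟩
  · exact hax ▸ ⟨z, hz, hzx⟩
  by_cases hay : a = ⟨r, y⟩
  · exact hay ▸ ⟨z, hz, hzy⟩
  exact QAtom.sat_subst_iff.1 (h.2 _ (Finset.mem_insert_of_mem (Finset.mem_image_of_mem _
    (Finset.mem_erase.2 ⟨hay, Finset.mem_erase.2 ⟨hax, ha⟩⟩))))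

theorem CQ.IsWitness.merge (h : c.IsWitness ν t B) (hθ : IsMGU θ x y)
    (hz : (⟨r, z⟩ : DBFact ar Γ) ∈ B) (hx : Matches ν x z) (hy : Matches ν y z) :
    (c.merge r x y θ).IsWitness ν t B := by
  classical
  have hν : (fun v => (θ v).eval ν) = ν := hθ.eval_eq (hx.unifies hy)
  refine ⟨fun k => (h.1 k).trans ?_, fun a ha => ?_⟩
  · exact ((Term.eval_subst ν θ _).trans (by rw [hν])).symm
  rcases Finset.mem_insert.1 ha with rfl | ha
  · exact ⟨z, hz, hθ.1.matches_mergedAtom_iff.2 (by rw [hν]; exact ⟨hx, hy⟩)⟩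
  · obtain ⟨b, hb, rfl⟩ := Finset.mem_image.1 ha
    rw [QAtom.sat_subst_iff, hν]
    exact h.2 b (Finset.mem_of_mem_erase (Finset.mem_of_mem_erase hb))

theorem CQ.card_body_merge_lt (hx : (⟨r, x⟩ : QAtom ar Γ) ∈ c.body)
    (hy : (⟨r, y⟩ : QAtom ar Γ) ∈ c.body) (hxy : x ≠ y) :
    (c.merge r x y θ).body.card < c.body.card := by
  classical
  have hy' : (⟨r, y⟩ : QAtom ar Γ) ∈ c.body.erase ⟨r, x⟩ :=
    Finset.mem_erase.2 ⟨fun h => hxy (eq_of_heq (QAtom.mk.inj h).2).symm, hy⟩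
  calc (c.merge r x y θ).body.card
      ≤ (((c.body.erase ⟨r, x⟩).erase ⟨r, y⟩).image (QAtom.subst θ)).card + 1 :=
        Finset.card_insert_le _ _
    _ ≤ ((c.body.erase ⟨r, x⟩).erase ⟨r, y⟩).card + 1 :=
        Nat.add_le_add_right Finset.card_image_le 1
    _ = (c.body.erase ⟨r, x⟩).card := Finset.card_erase_add_one hy'
    _ < c.body.card := Finset.card_erase_lt_of_mem hx

theorem CQ.Reduces.ans_subset (h : c.Reduces c') : c'.ans B ⊆ c.ans B := by
  obtain ⟨r, x, y, θ, -, -, -, hθ, rfl⟩ := CQ.reduces_iff.1 h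
  exact fun t ⟨ν, hν⟩ => ⟨_, CQ.IsWitness.of_merge hθ.1 hν⟩

theorem CQ.mem_ans_of_matches_up_to_unbound (hx : (⟨r, x⟩ : QAtom ar Γ) ∈ c.body)
    (hhead : ∀ k, t k = (c.head k).eval ν)
    (hothers : ∀ a ∈ c.body, a ≠ ⟨r, x⟩ → a.Sat ν B) (hz : (⟨r, z⟩ : DBFact ar Γ) ∈ B)
    (hzx : ∀ i, ∀ τ ∈ x i, z i = τ.eval ν ∨ ∃ v, τ = .var v ∧ c.Unbound v) : t ∈ c.ans B := by
  classical
  -- The unbound variables of `r(x)` occur nowhere else, so they may take the values of `z`.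
  let ν' : ℕ → Γ := fun v =>
    if h : ∃ i, x i = some (.var v) ∧ c.Unbound v then z h.choose else ν v
  have eval_eq : ∀ τ : Term ℕ Γ,
      (∀ v, τ = .var v → ¬ ∃ i, x i = some (.var v) ∧ c.Unbound v) → τ.eval ν' = τ.eval ν
    | .const _, _ => rfl
    | .var v, h => dif_neg (h v rfl)
  refine ⟨ν', fun k => (hhead k).trans (eval_eq _ ?_).symm, fun a ha => ?_⟩
  · rintro v hk ⟨i, -, hv⟩
    exact hv.1 k hk
  by_cases hax : a = ⟨r, x⟩
  · subst hax
    refine ⟨z, hz, fun i τ hτ => ?_⟩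
    by_cases hv : ∃ v, τ = .var v ∧ c.Unbound v
    · obtain ⟨v, rfl, hv⟩ := hv
      have hex : ∃ i, x i = some (.var v) ∧ c.Unbound v := ⟨i, hτ, hv⟩
      have same_occurrence := hv.2.unique (y₁ := ⟨⟨r, x⟩, i⟩) (y₂ := ⟨⟨r, x⟩, hex.choose⟩)
        ⟨hx, hτ⟩ ⟨hx, hex.choose_spec.1⟩
      have hi : i = hex.choose := eq_of_heq (Sigma.mk.inj same_occurrence).2
      have hν' : ν' v = z hex.choose := dif_pos hex
      exact (congrArg z hi).trans hν'.symm
    · refine ((hzx i τ hτ).resolve_right hv).trans (eval_eq τ ?_).symm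
      rintro v rfl ⟨-, -, hunbound⟩
      exact hv ⟨v, rfl, hunbound⟩
  · obtain ⟨w, hw, hwa⟩ := hothers a ha hax
    refine ⟨w, hw, fun i τ hτ => (hwa i τ hτ).trans (eval_eq τ ?_).symm⟩
    rintro v rfl ⟨i', hi', hv⟩
    exact hax (congrArg Sigma.fst
      (hv.2.unique (y₁ := ⟨a, i⟩) (y₂ := ⟨⟨r, x⟩, i'⟩) ⟨ha, hτ⟩ ⟨hx, hi'⟩))

theorem CQ.RewritesBy.ans_subset (h : CQ.RewritesBy d c c') (hB : d.Holds B) :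
    c'.ans B ⊆ c.ans B := by
  classical
  obtain ⟨u, hu, happ, rfl⟩ := CQ.rewritesBy_iff.1 h
  rintro t ⟨ν, hhead, hbody⟩
  obtain ⟨x, hx, hxu⟩ := hbody (d.rewriteAtom u) (Finset.mem_insert_self _ _)
  obtain ⟨y, hy, hyx⟩ := hB x hx
  refine CQ.mem_ans_of_matches_up_to_unbound hu hhead
    (fun a ha hau => hbody a (Finset.mem_insert_of_mem (Finset.mem_erase.2 ⟨hau, ha⟩))) hy ?_
  intro i τ hτ
  by_cases hi : i ∈ d.rightPos
  · obtain ⟨j, rfl⟩ := IND.mem_rightPos.1 hi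
    exact .inl ((hyx j).trans (IND.matches_rewriteAtom_iff.1 hxu j τ hτ))
  · rcases happ i hi with hnone | ⟨v, hv, hunbound⟩
    · exact nomatch hnone.symm.trans hτ
    · exact .inr ⟨v, Option.some.inj (hτ.symm.trans hv), hunbound⟩

theorem answers_perfectRewriting_subset (hB : ∀ d ∈ S.inds, d.Holds B) :
    answers (perfectRewriting S q) B ⊆ ucqAns q B := by
  rintro t ⟨c, hc, ht⟩
  have sound : perfectRewriting S q ⊆ {c | c.ans B ⊆ ucqAns q B} :=
    perfectRewriting_subset (fun c hc t ht => ⟨c, hc, ht⟩)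
      (fun c hc c' h => h.ans_subset.trans hc)
      fun d hd c hc c' h => (h.ans_subset (hB d hd)).trans hc
  exact sound hc ht

end Soundness

section OneInsertion

/-! ### Completeness of the perfect rewriting for one inserted fact -/

variable {S : Schema ar} {Q : Set (CQ ar Γ n)} {c : CQ ar Γ n} {d : IND ar}
  {K B : Set (DBFact ar Γ)} {F : Set Γ} {ν : ℕ → Γ} {t : Fin n → Γ}

theorem exists_injective_witness (hQ : rewritingStep S Q ⊆ Q) (ht : t ∈ answers Q B) :
    ∃ c ∈ Q, ∃ ν, c.IsWitness ν t B ∧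
      ∀ (r : R) (x y : Fin (ar r) → Option (Term ℕ Γ)) (z : Fin (ar r) → Γ),
        (⟨r, x⟩ : QAtom ar Γ) ∈ c.body → (⟨r, y⟩ : QAtom ar Γ) ∈ c.body →
        (⟨r, z⟩ : DBFact ar Γ) ∈ B → Matches ν x z → Matches ν y z → x = y := by
  -- In a shortest query with answer `t`, two atoms with a common image could still be merged.
  obtain ⟨c, ⟨hc, ν, hν⟩, hmin⟩ := exists_minimalFor_of_wellFoundedLT
    (fun c => c ∈ Q ∧ t ∈ c.ans B) (fun c => c.body.card) ht
  refine ⟨c, hc, ν, hν, fun r x y z hx hy hz hxz hyz => ?_⟩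
  by_contra hxy
  obtain ⟨θ, hθ⟩ := (hxz.unifies hyz).exists_isMGU
  have hmerge : c.merge r x y θ ∈ Q :=
    (CQ.reduces_iff.2 ⟨r, x, y, θ, hx, hy, hxy, hθ, rfl⟩).mem_of_rewritingStep_subset hQ hc
  have ht' : t ∈ (c.merge r x y θ).ans B := ⟨ν, CQ.IsWitness.merge hν hθ hz hxz hyz⟩
  have hlt := CQ.card_body_merge_lt (θ := θ) hx hy hxy
  exact (hmin ⟨hmerge, ht'⟩ hlt.le).not_gt hlt

/-- The values that occur in the database `K`. -/
def activeDomain (K : Set (DBFact ar Γ)) : Set Γ :=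
  ⋃ f ∈ K, Set.range f.args

/-- The constants that occur in the bodies of the queries in `Q`. -/
def bodyConstants (Q : Set (CQ ar Γ n)) : Set Γ :=
  ⋃ c ∈ Q, ⋃ a ∈ c.body, (fun e => some (.const e)) ⁻¹' Set.range a.args

theorem finite_activeDomain (hK : K.Finite) : (activeDomain K).Finite :=
  hK.biUnion fun _ _ => Set.finite_range _

theorem finite_bodyConstants (hQ : Q.Finite) : (bodyConstants Q).Finite :=
  hQ.biUnion fun c _ => c.body.finite_toSet.biUnion fun _ _ =>
    (Set.finite_range _).preimage
      (Function.Injective.injOn fun _ _ h => Term.const.inj (Option.some.inj h))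

theorem mem_activeDomain {r : R} {x : Fin (ar r) → Γ} (hx : (⟨r, x⟩ : DBFact ar Γ) ∈ K)
    (i : Fin (ar r)) : x i ∈ activeDomain K :=
  Set.mem_biUnion hx ⟨i, rfl⟩

theorem mem_bodyConstants {a : QAtom ar Γ} {i : Fin (ar a.rel)} {e : Γ} (hc : c ∈ Q)
    (ha : a ∈ c.body) (he : a.args i = some (.const e)) : e ∈ bodyConstants Q :=
  Set.mem_biUnion hc (Set.mem_biUnion ha ⟨i, he⟩)

/-- The tuple `y` carries the values of `x` along `d`, and pairwise distinct values outside `F`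
at the remaining positions: the arguments of the fact that the chase inserts for `x`. -/
structure IND.FreshImage (d : IND ar) (F : Set Γ) (x : Fin (ar d.lhs) → Γ)
    (y : Fin (ar d.rhs) → Γ) : Prop where
  right : ∀ j, y (d.right j) = x (d.left j)
  fresh : ∀ i, i ∉ d.rightPos → y i ∉ F
  inj : ∀ i, i ∉ d.rightPos → ∀ i', y i' = y i → i' = i

theorem IND.exists_freshImage [Infinite Γ] (d : IND ar) (hF : F.Finite)
    {x : Fin (ar d.lhs) → Γ} (hx : ∀ i, x i ∈ F) : ∃ y, d.FreshImage F x y := by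
  let e : ℕ ↪ (Fᶜ : Set Γ) := hF.infinite_compl.natEmbedding
  let y : Fin (ar d.rhs) → Γ := Function.extend d.right (x ∘ d.left) fun i => e i
  have y_right : ∀ j, y (d.right j) = x (d.left j) := d.right.injective.extend_apply _ _
  have y_fresh : ∀ i, i ∉ d.rightPos → y i = e i := fun i hi =>
    Function.extend_apply' _ _ _ fun h => hi (IND.mem_rightPos.2 h)
  have fresh : ∀ i, i ∉ d.rightPos → y i ∉ F := fun i hi => y_fresh i hi ▸ (e i).2
  refine ⟨y, y_right, fresh, fun i hi i' h => ?_⟩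
  by_cases hi' : i' ∈ d.rightPos
  · obtain ⟨j, rfl⟩ := IND.mem_rightPos.1 hi'
    exact (fresh i hi (h ▸ y_right j ▸ hx _)).elim
  · rw [y_fresh i hi, y_fresh i' hi'] at h
    exact Fin.ext (e.injective (Subtype.ext h))

theorem IND.FreshImage.applicable {x : Fin (ar d.lhs) → Γ} {y : Fin (ar d.rhs) → Γ}
    (hy : d.FreshImage F x y) {u : Fin (ar d.rhs) → Option (Term ℕ Γ)}
    (hu : (⟨d.rhs, u⟩ : QAtom ar Γ) ∈ c.body) (huy : Matches ν u y)
    (hconst : ∀ i e, u i = some (.const e) → e ∈ F)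
    (hhead : ∀ k, (c.head k).eval ν ∈ F)
    (hothers : ∀ a ∈ c.body, a ≠ ⟨d.rhs, u⟩ → ∀ i, ∀ τ ∈ a.args i, τ.eval ν ∈ F) :
    d.Applicable c u := by
  intro i hi
  cases hui : u i with
  | none => exact .inl rfl
  | some τ =>
    have hyi : y i = τ.eval ν := huy i τ hui
    have not_mem : τ.eval ν ∉ F := hyi ▸ hy.fresh i hi
    cases τ with
    | const e => exact (not_mem (hconst i e hui)).elim
    | var v =>
      refine .inr ⟨v, rfl, fun k hk => not_mem (hk ▸ hhead k), ⟨⟨d.rhs, u⟩, i⟩, ⟨hu, hui⟩, ?_⟩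
      rintro ⟨a, i'⟩ ⟨ha, hai'⟩
      by_cases hau : a = ⟨d.rhs, u⟩
      · subst hau
        rw [hy.inj i hi i' ((huy i' _ hai').trans hyi.symm)]
      · exact (not_mem (hothers a ha hau i' _ hai')).elim

theorem mem_answers_of_mem_answers_insert (hQ : rewritingStep S Q ⊆ Q) (hd : d ∈ S.inds)
    {x : Fin (ar d.lhs) → Γ} {y : Fin (ar d.rhs) → Γ} (hx : (⟨d.lhs, x⟩ : DBFact ar Γ) ∈ K)
    (hy : d.FreshImage F x y) (hKF : activeDomain K ⊆ F) (hQF : bodyConstants Q ⊆ F)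
    (htF : Set.range t ⊆ F) (ht : t ∈ answers Q (insert ⟨d.rhs, y⟩ K)) : t ∈ answers Q K := by
  classical
  obtain ⟨c, hc, ν, ⟨hhead, hbody⟩, hinj⟩ := exists_injective_witness hQ ht
  by_cases hall : ∀ a ∈ c.body, a.Sat ν K
  · exact ⟨c, hc, ν, hhead, hall⟩
  push Not at hall
  obtain ⟨⟨r, u⟩, hu, huK⟩ := hall
  obtain ⟨z, hz | hz, hzu⟩ := hbody _ hu
  swap
  · exact (huK ⟨z, hz, hzu⟩).elim
  cases hz
  have hothers : ∀ a ∈ c.body, a ≠ ⟨d.rhs, u⟩ → a.Sat ν K := by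
    rintro ⟨r, v⟩ ha hau
    obtain ⟨w, hw | hw, hwa⟩ := hbody _ ha
    · cases hw
      exact (hau (congrArg _ (hinj d.rhs v u y ha hu (.inl rfl) hwa hzu))).elim
    · exact ⟨w, hw, hwa⟩
  have happ : d.Applicable c u := by
    refine hy.applicable hu hzu (fun i e he => hQF (mem_bodyConstants hc hu he))
      (fun k => htF ⟨k, hhead k⟩) fun a ha hau i τ hτ => ?_
    obtain ⟨w, hw, hwa⟩ := hothers a ha hau
    exact hwa i τ hτ ▸ hKF (mem_activeDomain hw i)
  have hrewrite : c.rewrite d u ∈ Q :=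
    (CQ.rewritesBy_iff.2 ⟨u, hu, happ, rfl⟩).mem_of_rewritingStep_subset hQ hd hc
  refine ⟨c.rewrite d u, hrewrite, ν, hhead, fun a ha => ?_⟩
  rcases Finset.mem_insert.1 ha with rfl | ha
  · exact ⟨x, hx, IND.matches_rewriteAtom_iff.2 fun j τ hτ => (hy.right j).symm.trans (hzu _ τ hτ)⟩
  · exact hothers a (Finset.mem_of_mem_erase ha) (Finset.ne_of_mem_erase ha)

end OneInsertion

section Keys

/-! ### Key dependencies under insertion -/

variable {S : Schema ar} {d : IND ar} {K B B' : Set (DBFact ar Γ)} {F : Set Γ} {r : R}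
  {x : Fin (ar r) → Γ}

theorem Schema.KeysHold.mono (hB' : S.KeysHold B') (h : B ⊆ B') : S.KeysHold B :=
  fun r i hi x₁ x₂ hkey hx => hB' r i hi x₁ x₂ hkey ⟨h hx.1, h hx.2.1, hx.2.2⟩

theorem Schema.KeysHold.insert (hB : S.KeysHold B)
    (hx : ∀ y, (⟨r, y⟩ : DBFact ar Γ) ∈ B → ¬ ∀ j ∈ S.key r, x j = y j) :
    S.KeysHold (insert ⟨r, x⟩ B) := by
  rintro r' i hi y₁ y₂ hkey ⟨h₁ | h₁, h₂ | h₂, hne⟩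
  · cases h₁
    cases h₂
    exact hne rfl
  · cases h₁
    exact hx y₂ h₂ hkey
  · cases h₂
    exact hx y₁ h₁ fun j hj => (hkey j hj).symm
  · exact hB r' i hi y₁ y₂ hkey ⟨h₁, h₂, hne⟩

theorem Schema.KeysHold.iUnion_of_directed {ι : Type*} {B : ι → Set (DBFact ar Γ)}
    (hdir : Directed (· ⊆ ·) B) (hB : ∀ i, S.KeysHold (B i)) : S.KeysHold (⋃ i, B i) := by
  rintro r i hi x₁ x₂ hkey ⟨h₁, h₂, hne⟩
  obtain ⟨m₁, h₁⟩ := Set.mem_iUnion.1 h₁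
  obtain ⟨m₂, h₂⟩ := Set.mem_iUnion.1 h₂
  obtain ⟨m, hm₁, hm₂⟩ := hdir m₁ m₂
  exact hB m r i hi x₁ x₂ hkey ⟨hm₁ h₁, hm₂ h₂, hne⟩

/-- The fact `d.lhs(x)` does not violate `d` over `B`; it need not belong to `B`. -/
def IND.SatisfiedAt (d : IND ar) (B : Set (DBFact ar Γ)) (x : Fin (ar d.lhs) → Γ) : Prop :=
  ∃ y : Fin (ar d.rhs) → Γ, (⟨d.rhs, y⟩ : DBFact ar Γ) ∈ B ∧ ∀ j, y (d.right j) = x (d.left j)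

theorem IND.SatisfiedAt.mono {x : Fin (ar d.lhs) → Γ} (h : d.SatisfiedAt B x) (hB : B ⊆ B') :
    d.SatisfiedAt B' x :=
  h.imp fun _ hy => ⟨hB hy.1, hy.2⟩

theorem IND.FreshImage.not_agree_on_key {x : Fin (ar d.lhs) → Γ} {y z : Fin (ar d.rhs) → Γ}
    (hy : d.FreshImage F x y) (hd : S.NKC d) (hKF : activeDomain K ⊆ F)
    (hx : ¬ d.SatisfiedAt K x) (hz : (⟨d.rhs, z⟩ : DBFact ar Γ) ∈ K) :
    ¬ ∀ j ∈ S.key d.rhs, y j = z j := by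
  intro hyz
  by_cases hsub : S.key d.rhs ⊆ d.rightPos
  · -- Under NKC the key consists of exactly the propagated positions.
    have hsup : d.rightPos ⊆ S.key d.rhs := by_contra fun h => hd ⟨hsub, h⟩
    exact hx ⟨z, hz, fun j =>
      (hyz _ (hsup (IND.mem_rightPos.2 ⟨j, rfl⟩))).symm.trans (hy.right j)⟩
  · obtain ⟨i, hi, hi'⟩ := Finset.not_subset.1 hsub
    exact hy.fresh i hi' (hyz i hi ▸ hKF (mem_activeDomain hz i))

end Keys

section Chase

/-! ### The chase -/

variable {S : Schema ar} {Q : Set (CQ ar Γ n)} {t : Fin n → Γ} {K K₁ K₂ K₃ : Set (DBFact ar Γ)}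
  {d : IND ar}

/-- `K'` is a finite database that satisfies the keys, extends `K`, and does not make `t` an
answer to `Q` unless it is one over `K`. -/
structure ConservativeExtension (S : Schema ar) (Q : Set (CQ ar Γ n)) (t : Fin n → Γ)
    (K K' : Set (DBFact ar Γ)) : Prop where
  subset : K ⊆ K'
  finite : K'.Finite
  keysHold : S.KeysHold K'
  mem_answers : t ∈ answers Q K' → t ∈ answers Q K

theorem ConservativeExtension.refl (hK : K.Finite) (hkeys : S.KeysHold K) :
    ConservativeExtension S Q t K K :=
  ⟨subset_rfl, hK, hkeys, id⟩

theorem ConservativeExtension.trans (h₁ : ConservativeExtension S Q t K₁ K₂)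
    (h₂ : ConservativeExtension S Q t K₂ K₃) : ConservativeExtension S Q t K₁ K₃ :=
  ⟨h₁.subset.trans h₂.subset, h₂.finite, h₂.keysHold, h₁.mem_answers ∘ h₂.mem_answers⟩

theorem exists_conservativeExtension_satisfiedAt [Infinite Γ] (hQ : rewritingStep S Q ⊆ Q)
    (hQfin : Q.Finite) (t : Fin n → Γ) (hd : d ∈ S.inds) (hNKC : S.NKC d) (hK : K.Finite)
    (hkeys : S.KeysHold K) {x : Fin (ar d.lhs) → Γ} (hx : (⟨d.lhs, x⟩ : DBFact ar Γ) ∈ K) :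
    ∃ K', ConservativeExtension S Q t K K' ∧ d.SatisfiedAt K' x := by
  by_cases hsat : d.SatisfiedAt K x
  · exact ⟨K, .refl hK hkeys, hsat⟩
  let F : Set Γ := activeDomain K ∪ bodyConstants Q ∪ Set.range t
  have hF : F.Finite :=
    ((finite_activeDomain hK).union (finite_bodyConstants hQfin)).union (Set.finite_range t)
  have hKF : activeDomain K ⊆ F := fun _ he => .inl (.inl he)
  obtain ⟨y, hy⟩ := d.exists_freshImage hF fun i => hKF (mem_activeDomain hx i)
  refine ⟨insert ⟨d.rhs, y⟩ K, ⟨Set.subset_insert _ _, hK.insert _, ?_, ?_⟩,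
    y, Set.mem_insert _ _, hy.right⟩
  · exact hkeys.insert fun z hz => hy.not_agree_on_key hNKC hKF hsat hz
  · exact mem_answers_of_mem_answers_insert hQ hd hx hy hKF (fun _ he => .inl (.inr he))
      fun _ he => .inr he

theorem exists_conservativeExtension_forall_satisfiedAt [Infinite Γ] (hQ : rewritingStep S Q ⊆ Q)
    (hQfin : Q.Finite) (t : Fin n → Γ) (hNKC : ∀ d ∈ S.inds, S.NKC d) (hK : K.Finite)
    (hkeys : S.KeysHold K) :
    ∃ K', ConservativeExtension S Q t K K' ∧
      ∀ d ∈ S.inds, ∀ x : Fin (ar d.lhs) → Γ, ⟨d.lhs, x⟩ ∈ K → d.SatisfiedAt K' x := by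
  let triggers : Set ((d : IND ar) × (Fin (ar d.lhs) → Γ)) :=
    ⋃ d ∈ S.inds, Sigma.mk d '' (DBFact.mk d.lhs ⁻¹' K)
  have triggers_finite : triggers.Finite := S.inds.finite_toSet.biUnion fun d _ =>
    (hK.preimage (Function.Injective.injOn fun x x' h => by simpa using h)).image _
  suffices ∃ K', ConservativeExtension S Q t K K' ∧ ∀ p ∈ triggers, p.1.SatisfiedAt K' p.2 by
    obtain ⟨K', hK', hsat⟩ := this
    exact ⟨K', hK', fun d hd x hx => hsat ⟨d, x⟩ (Set.mem_biUnion hd ⟨x, hx, rfl⟩)⟩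
  refine triggers_finite.induction_on_subset (motive := fun T _ =>
    ∃ K', ConservativeExtension S Q t K K' ∧ ∀ p ∈ T, p.1.SatisfiedAt K' p.2)
    _ ⟨K, .refl hK hkeys, nofun⟩ ?_
  rintro p T hp - - ⟨K₁, hK₁, hsat₁⟩
  obtain ⟨d, hd, x, hx, rfl⟩ := Set.mem_iUnion₂.1 hp
  obtain ⟨K₂, hK₂, hsat₂⟩ := exists_conservativeExtension_satisfiedAt hQ hQfin t hd (hNKC d hd)
    hK₁.finite hK₁.keysHold (hK₁.subset hx)
  refine ⟨K₂, hK₁.trans hK₂, ?_⟩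
  rintro p' (rfl | hp')
  exacts [hsat₂, (hsat₁ p' hp').mono hK₂.subset]

theorem exists_conservativeExtension_sequence [Infinite Γ] (hQ : rewritingStep S Q ⊆ Q)
    (hQfin : Q.Finite) (t : Fin n → Γ) (hNKC : ∀ d ∈ S.inds, S.NKC d) (hK : K.Finite)
    (hkeys : S.KeysHold K) :
    ∃ C : ℕ → Set (DBFact ar Γ), (∀ m, ConservativeExtension S Q t K (C m)) ∧ Monotone C ∧
      ∀ m, ∀ d ∈ S.inds, ∀ x : Fin (ar d.lhs) → Γ, ⟨d.lhs, x⟩ ∈ C m →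
        d.SatisfiedAt (C (m + 1)) x := by
  have exists_next : ∀ K₁ : {K' // ConservativeExtension S Q t K K'},
      ∃ K₂ : {K' // ConservativeExtension S Q t K K'}, K₁.1 ⊆ K₂.1 ∧
        ∀ d ∈ S.inds, ∀ x : Fin (ar d.lhs) → Γ, ⟨d.lhs, x⟩ ∈ K₁.1 → d.SatisfiedAt K₂.1 x := by
    rintro ⟨K₁, hK₁⟩
    obtain ⟨K₂, hK₂, hsat⟩ := exists_conservativeExtension_forall_satisfiedAt hQ hQfin t hNKC
      hK₁.finite hK₁.keysHold
    exact ⟨⟨K₂, hK₁.trans hK₂⟩, hK₂.subset, hsat⟩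
  choose next subset_next satisfied_next using exists_next
  let C : ℕ → {K' // ConservativeExtension S Q t K K'} := fun m => next^[m] ⟨K, .refl hK hkeys⟩
  have C_succ : ∀ m, C (m + 1) = next (C m) := fun m => Function.iterate_succ_apply' _ _ _
  refine ⟨fun m => (C m).1, fun m => (C m).2, monotone_nat_of_le_succ fun m => ?_,
    fun m d hd x hx => ?_⟩
  · rw [C_succ]
    exact subset_next (C m)
  · simpa only [C_succ] using satisfied_next (C m) d hd x hx

theorem CQ.exists_mem_ans_of_mem_ans_iUnion {ι : Type*} [Nonempty ι]
    {B : ι → Set (DBFact ar Γ)} (hdir : Directed (· ⊆ ·) B) {c : CQ ar Γ n}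
    (ht : t ∈ c.ans (⋃ i, B i)) : ∃ i, t ∈ c.ans (B i) := by
  classical
  obtain ⟨ν, hhead, hbody⟩ := ht
  have exists_stage : ∀ a ∈ c.body, ∃ i, a.Sat ν (B i) := fun a ha => by
    obtain ⟨x, hx, hxa⟩ := hbody a ha
    obtain ⟨i, hi⟩ := Set.mem_iUnion.1 hx
    exact ⟨i, x, hi, hxa⟩
  choose! stage sat_stage using exists_stage
  obtain ⟨i, hi⟩ := hdir.finset_le (c.body.image stage)
  exact ⟨i, ν, hhead, fun a ha => (sat_stage a ha).mono (hi _ (Finset.mem_image_of_mem _ ha))⟩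

theorem exists_consistent_superset_mem_answers [Infinite Γ] (hQ : rewritingStep S Q ⊆ Q)
    (hQfin : Q.Finite) (t : Fin n → Γ) (hNKC : ∀ d ∈ S.inds, S.NKC d) (hK : K.Finite)
    (hkeys : S.KeysHold K) :
    ∃ B, K ⊆ B ∧ S.Consistent B ∧ (t ∈ answers Q B → t ∈ answers Q K) := by
  obtain ⟨C, hC, hmono, hsat⟩ :=
    exists_conservativeExtension_sequence hQ hQfin t hNKC hK hkeys
  have hdir : Directed (· ⊆ ·) C := hmono.directed_le
  refine ⟨⋃ m, C m, Set.subset_iUnion_of_subset 0 (hC 0).subset, ⟨?_, fun d hd x hx => ?_⟩, ?_⟩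
  · exact .iUnion_of_directed hdir fun m => (hC m).keysHold
  · obtain ⟨m, hm⟩ := Set.mem_iUnion.1 hx
    exact (hsat m d hd x hm).mono (Set.subset_iUnion C (m + 1))
  · rintro ⟨c, hc, ht⟩
    obtain ⟨m, hm⟩ := CQ.exists_mem_ans_of_mem_ans_iUnion hdir ht
    exact (hC m).mem_answers ⟨c, hc, hm⟩

theorem exists_consistent_superset [Infinite Γ] (hNKC : ∀ d ∈ S.inds, S.NKC d) (hK : K.Finite)
    (hkeys : S.KeysHold K) : ∃ B, K ⊆ B ∧ S.Consistent B := by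
  have closed : rewritingStep S (∅ : Set (CQ ar Γ 0)) ⊆ ∅ := by simp [rewritingStep]
  obtain ⟨B, hKB, hB, -⟩ := exists_consistent_superset_mem_answers closed Set.finite_empty
    Fin.elim0 hNKC hK hkeys
  exact ⟨B, hKB, hB⟩

end Chase

section Reduct

/-! ### Models of the reduct -/

variable {P P' : Set (AspRule ar Γ n)} {M N : Set (AspAtom ar n Γ)} {S : Schema ar}
  {D : Set (DBFact ar Γ)} {q : Finset (CQ ar Γ n)} {c : CQ ar Γ n} {t : Fin n → Γ} {r : R}

/-- The facts `g(x)` with `g(x) ∈ N`. -/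
def baseFacts (N : Set (AspAtom ar n Γ)) : Set (DBFact ar Γ) :=
  {f | .base f.rel f.args ∈ N}

/-- The facts `g(x)` with `gᶜ(x) ∈ N`. -/
def deletedFacts (N : Set (AspAtom ar n Γ)) : Set (DBFact ar Γ) :=
  {f | .del f.rel f.args ∈ N}

/-- The facts `g(x)` with `gʳ(x) ∈ N`. -/
def repairedFacts (N : Set (AspAtom ar n Γ)) : Set (DBFact ar Γ) :=
  {f | .rep f.rel f.args ∈ N}

theorem isModel_reduct_grounding_iff :
    IsModel (reduct (grounding P) M) N ↔ ∀ ρ ∈ P, ∀ ν : PVar ar Γ → Γ,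
      (∀ e ∈ ρ.neq, e.1.eval ν ≠ e.2.eval ν) → (∀ a ∈ ρ.neg, a.map (Term.eval ν) ∉ M) →
      (∀ a ∈ ρ.pos, a.map (Term.eval ν) ∈ N) → ∃ a ∈ ρ.head, a.map (Term.eval ν) ∈ N := by
  constructor
  · intro h ρ hρ ν hneq hneg hpos
    have hsat := h _ ⟨ρ.ground ν, ⟨ρ, hρ, ν, hneq, rfl⟩, List.forall_mem_map.2 hneg, rfl⟩
    obtain ⟨_, hg, hgN⟩ := hsat (List.forall_mem_map.2 hpos) (List.forall_mem_nil _)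
    obtain ⟨a, ha, rfl⟩ := List.mem_map.1 hg
    exact ⟨a, ha, hgN⟩
  · rintro h _ ⟨_, ⟨ρ, hρ, ν, hneq, rfl⟩, hneg, rfl⟩ hpos -
    obtain ⟨a, ha, haN⟩ := h ρ hρ ν hneq (fun a ha => hneg _ (List.mem_map_of_mem ha))
      fun a ha => hpos _ (List.mem_map_of_mem ha)
    exact ⟨_, List.mem_map_of_mem ha, haN⟩

theorem isModel_reduct_grounding_union :
    IsModel (reduct (grounding (P ∪ P')) M) N ↔
      IsModel (reduct (grounding P) M) N ∧ IsModel (reduct (grounding P') M) N := by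
  simp only [isModel_reduct_grounding_iff, Set.mem_union, or_imp, forall_and]

theorem isModel_reduct_factRules_iff [Nonempty Γ] :
    IsModel (reduct (grounding (factRules n D)) M) N ↔ D ⊆ baseFacts N := by
  rw [isModel_reduct_grounding_iff]
  constructor
  · intro h f hf
    obtain ⟨a, ha, haN⟩ := h _ ⟨f, hf, rfl⟩ (fun _ => Classical.arbitrary Γ)
      (List.forall_mem_nil _) (List.forall_mem_nil _) (List.forall_mem_nil _)
    rwa [List.mem_singleton.1 ha] at haN
  · rintro h _ ⟨f, hf, rfl⟩ ν - - -
    exact ⟨_, List.mem_singleton_self _, h hf⟩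

theorem exists_eval_keyVars_eq [Nonempty Γ] (S : Schema ar) {x₁ x₂ : Fin (ar r) → Γ}
    (hkey : ∀ j ∈ S.key r, x₁ j = x₂ j) :
    ∃ ν : PVar ar Γ → Γ, Term.eval ν ∘ keyVars₁ r = x₁ ∧ Term.eval ν ∘ keyVars₂ S r = x₂ := by
  let e := Classical.arbitrary Γ
  refine ⟨Sum.elim (fun k => if hk : k < ar r then x₁ ⟨k, hk⟩ else
    if hk : k - ar r < ar r then x₂ ⟨k - ar r, hk⟩ else e) fun _ => e,
    funext fun i => ?_, funext fun i => ?_⟩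
  · simp [keyVars₁, Term.eval]
  · by_cases hi : i ∈ S.key r
    · simp [keyVars₂, Term.eval, hi, hkey i hi]
    · simp [keyVars₂, Term.eval, hi]

theorem keyVars₁_eq_keyVars₂ {j : Fin (ar r)} (hj : j ∈ S.key r) :
    (keyVars₁ r j : Term (PVar ar Γ) Γ) = keyVars₂ S r j := by
  simp only [keyVars₁, keyVars₂, if_pos hj]

theorem isModel_reduct_keyRules_iff [Nonempty Γ] :
    IsModel (reduct (grounding (keyRules S)) M) N ↔
      S.KeysHold (baseFacts N \ deletedFacts N) := by
  rw [isModel_reduct_grounding_iff]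
  constructor
  · rintro h r i hi x₁ x₂ hkey ⟨⟨h₁, h₁'⟩, ⟨h₂, h₂'⟩, hne⟩
    obtain ⟨ν, rfl, rfl⟩ := exists_eval_keyVars_eq S hkey
    obtain ⟨a, ha, haN⟩ := h _ ⟨r, i, hi, rfl⟩ ν (List.forall_mem_singleton.2 hne)
      (List.forall_mem_nil _) (by simpa [AspAtom.map] using ⟨h₁, h₂⟩)
    rcases List.mem_pair.1 ha with rfl | rfl
    exacts [h₁' haN, h₂' haN]
  · rintro h _ ⟨r, i, hi, rfl⟩ ν hneq - hpos
    by_contra! hdel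
    refine h r i hi _ _ (fun j hj => congrArg (Term.eval ν) (keyVars₁_eq_keyVars₂ hj))
      ⟨⟨hpos (.base r (keyVars₁ r)) ?_, hdel (.del r (keyVars₁ r)) ?_⟩,
        ⟨hpos (.base r (keyVars₂ S r)) ?_, hdel (.del r (keyVars₂ S r)) ?_⟩,
        hneq _ (List.mem_singleton_self _)⟩ <;> simp

theorem isModel_reduct_repairRules_iff [Nonempty Γ] :
    IsModel (reduct (grounding repairRules) M) N ↔
      baseFacts N \ deletedFacts M ⊆ repairedFacts N := by
  rw [isModel_reduct_grounding_iff]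
  constructor
  · rintro h ⟨r, x⟩ ⟨hx, hx'⟩
    obtain ⟨ν, rfl, -⟩ := exists_eval_keyVars_eq (⟨fun _ => ∅, ∅⟩ : Schema ar) (x₁ := x)
      (x₂ := x) fun _ _ => rfl
    obtain ⟨a, ha, haN⟩ := h _ ⟨r, rfl⟩ ν (List.forall_mem_nil _)
      (List.forall_mem_singleton.2 hx') (List.forall_mem_singleton.2 hx)
    rwa [List.mem_singleton.1 ha] at haN
  · rintro h _ ⟨r, rfl⟩ ν - hneg hpos
    exact ⟨_, List.mem_singleton_self _, h (a := ⟨r, Term.eval ν ∘ keyVars₁ r⟩)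
      ⟨hpos _ (List.mem_singleton_self _), hneg _ (List.mem_singleton_self _)⟩⟩

theorem QAtom.map_eval_repaired (μ : PVar ar Γ → Γ) (a : QAtom ar Γ) :
    (QAtom.repaired n a).map (Term.eval μ) = .rep a.rel fun i =>
      (a.args i).elim (μ (.inr (a, i))) (Term.eval fun v => μ (.inl v)) := by
  refine congrArg (AspAtom.rep a.rel) (funext fun i => ?_)
  simp only [Function.comp_apply]
  cases a.args i with
  | none => rfl
  | some τ => exact Term.eval_subst _ _ _

theorem CQ.exists_eval_repaired_mem [Nonempty Γ] {ν : ℕ → Γ}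
    (h : ∀ a ∈ c.body, a.Sat ν (repairedFacts N)) :
    ∃ μ : PVar ar Γ → Γ, (∀ v, μ (.inl v) = ν v) ∧
      ∀ a ∈ c.body, (QAtom.repaired n a).map (Term.eval μ) ∈ N := by
  have exists_args : ∀ a : QAtom ar Γ, ∃ x : Fin (ar a.rel) → Γ, a ∈ c.body →
      .rep a.rel x ∈ N ∧ ∀ i, ∀ τ ∈ a.args i, x i = τ.eval ν := fun a => by
    by_cases ha : a ∈ c.body
    · exact (h a ha).imp fun x hx _ => hx
    · exact ⟨fun _ => Classical.arbitrary Γ, fun ha' => (ha ha').elim⟩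
  choose x hx using exists_args
  refine ⟨Sum.elim ν fun p =>
    if hp : p.2 < ar p.1.rel then x p.1 ⟨p.2, hp⟩ else Classical.arbitrary Γ,
    fun _ => rfl, fun a ha => ?_⟩
  rw [QAtom.map_eval_repaired]
  convert (hx a ha).1 using 2
  ext i
  cases hi : a.args i with
  | none => simp
  | some τ => exact ((hx a ha).2 i τ hi).symm

theorem CQ.mem_ans_repairedFacts_iff [Nonempty Γ] :
    t ∈ c.ans (repairedFacts N) ↔ ∃ μ : PVar ar Γ → Γ,
      (∀ a ∈ c.body, (QAtom.repaired n a).map (Term.eval μ) ∈ N) ∧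
      ∀ k, t k = ((c.head k).subst fun v => .var (.inl v)).eval μ := by
  simp only [Term.eval_subst]
  constructor
  · rintro ⟨ν, hhead, hν⟩
    obtain ⟨μ, hμν, hμ⟩ := CQ.exists_eval_repaired_mem hν
    obtain rfl : (fun v => μ (.inl v)) = ν := funext hμν
    exact ⟨μ, hμ, hhead⟩
  · rintro ⟨μ, hbody, hhead⟩
    refine ⟨fun v => μ (.inl v), hhead, fun a ha => ?_⟩
    have hrep := hbody a ha
    rw [QAtom.map_eval_repaired] at hrep
    exact ⟨_, hrep, fun i τ hτ => by simp [Option.mem_def.1 hτ]⟩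

theorem isModel_reduct_queryRules_iff [Nonempty Γ] :
    IsModel (reduct (grounding (queryRules S q)) M) N ↔
      ∀ t ∈ answers (perfectRewriting S q) (repairedFacts N), .query t ∈ N := by
  rw [isModel_reduct_grounding_iff]
  constructor
  · rintro h t ⟨c, hc, ht⟩
    obtain ⟨μ, hbody, hhead⟩ := CQ.mem_ans_repairedFacts_iff.1 ht
    obtain ⟨a, ha, haN⟩ := h _ ⟨c, hc, rfl⟩ μ (List.forall_mem_nil _) (List.forall_mem_nil _)
      (List.forall_mem_map.2 fun a ha => hbody a (Finset.mem_toList.1 ha))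
    rw [List.mem_singleton.1 ha] at haN
    rwa [funext hhead]
  · rintro h _ ⟨c, hc, rfl⟩ μ - - hpos
    exact ⟨_, List.mem_singleton_self _, h _ ⟨c, hc, CQ.mem_ans_repairedFacts_iff.2
      ⟨μ, fun a ha => List.forall_mem_map.1 hpos a (Finset.mem_toList.2 ha), fun _ => rfl⟩⟩⟩

/-- The ground program whose answer sets define cautious consequence. -/
def groundProgram (S : Schema ar) (D : Set (DBFact ar Γ)) (q : Finset (CQ ar Γ n)) :
    Set (GroundRule (AspAtom ar n Γ)) :=
  grounding (factRules n D ∪ cqaProgram S q)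

theorem isModel_reduct_groundProgram_iff [Nonempty Γ] :
    IsModel (reduct (groundProgram S D q) M) N ↔
      D ⊆ baseFacts N ∧ S.KeysHold (baseFacts N \ deletedFacts N) ∧
      baseFacts N \ deletedFacts M ⊆ repairedFacts N ∧
      ∀ t ∈ answers (perfectRewriting S q) (repairedFacts N), .query t ∈ N := by
  simp only [groundProgram, cqaProgram, isModel_reduct_grounding_union,
    isModel_reduct_factRules_iff, isModel_reduct_keyRules_iff, isModel_reduct_repairRules_iff,
    isModel_reduct_queryRules_iff, and_assoc]

end Reduct

section AnswerSets

/-! ### Answer sets and key repairs -/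

variable {S : Schema ar} {D X K : Set (DBFact ar Γ)} {q : Finset (CQ ar Γ n)}
  {M : Set (AspAtom ar n Γ)} {t : Fin n → Γ}

/-- `K` is a repair of `D` with respect to the keys alone: a maximal subset of `D` that satisfies
them. -/
def IsKeyRepair (S : Schema ar) (D K : Set (DBFact ar Γ)) : Prop :=
  Maximal (fun K => K ⊆ D ∧ S.KeysHold K) K

/-- The interpretation with base facts `D`, deleted facts `X`, repaired facts `K`, and the answers
to the perfect rewriting of `q` over `K`. -/
def interpretation (S : Schema ar) (q : Finset (CQ ar Γ n)) (D X K : Set (DBFact ar Γ)) :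
    Set (AspAtom ar n Γ)
  | .base r x => ⟨r, x⟩ ∈ D
  | .del r x => ⟨r, x⟩ ∈ X
  | .rep r x => ⟨r, x⟩ ∈ K
  | .query t => t ∈ answers (perfectRewriting S q) K

theorem interpretation_subset (hD : D ⊆ baseFacts M) (hX : X ⊆ deletedFacts M)
    (hK : K ⊆ repairedFacts M) (hq : ∀ t ∈ answers (perfectRewriting S q) K, .query t ∈ M) :
    interpretation S q D X K ⊆ M := by
  rintro (⟨r, x⟩ | ⟨r, x⟩ | ⟨r, x⟩ | t) h
  exacts [hD h, hX h, hK h, hq t h]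

theorem isModel_reduct_interpretation [Nonempty Γ] (hX : S.KeysHold (D \ X))
    (hK : D \ deletedFacts M ⊆ K) :
    IsModel (reduct (groundProgram S D q) M) (interpretation S q D X K) :=
  isModel_reduct_groundProgram_iff.2 ⟨subset_rfl, hX, hK, fun _ ht => ht⟩

theorem IsKeyRepair.isAnswerSet [Nonempty Γ] (h : IsKeyRepair S D K) :
    IsAnswerSet (groundProgram S D q) (interpretation S q D (D \ K) K) := by
  have sdiff_sdiff : D \ (D \ K) = K := Set.sdiff_sdiff_cancel_left h.prop.1
  refine ⟨isModel_reduct_interpretation (sdiff_sdiff.symm ▸ h.prop.2) sdiff_sdiff.subset,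
    fun N hN hmodel => ?_⟩
  obtain ⟨hbase, hkeys, hrep, hquery⟩ := isModel_reduct_groundProgram_iff.1 hmodel
  have subset_repaired : K ⊆ repairedFacts N := fun f hf =>
    hrep ⟨hbase (h.prop.1 hf), fun hf' => hf'.2 hf⟩
  -- The facts of `D` that `N` does not delete include `K` and satisfy the keys.
  have undeleted_subset : D \ deletedFacts N ⊆ K :=
    h.le_of_ge ⟨Set.sdiff_subset, hkeys.mono (Set.sdiff_subset_sdiff_left hbase)⟩
      fun f hf => ⟨h.prop.1 hf, fun hf' => (hN hf').2 hf⟩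
  exact hN.antisymm <| interpretation_subset hbase (Set.sdiff_subset_comm.1 undeleted_subset)
    subset_repaired fun t ht => hquery t (answers_mono subset_repaired ht)

theorem IsAnswerSet.eq_interpretation [Nonempty Γ] (hM : IsAnswerSet (groundProgram S D q) M)
    (hX : X ⊆ deletedFacts M) (hkeys : S.KeysHold (D \ X)) :
    M = interpretation S q D X (D \ deletedFacts M) := by
  obtain ⟨hbase, -, hrep, hquery⟩ := isModel_reduct_groundProgram_iff.1 hM.1
  have subset_repaired : D \ deletedFacts M ⊆ repairedFacts M :=
    (Set.sdiff_subset_sdiff_left hbase).trans hrep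
  refine (hM.2 _ (interpretation_subset hbase hX subset_repaired fun t ht => ?_)
    (isModel_reduct_interpretation hkeys subset_rfl)).symm
  exact hquery t (answers_mono subset_repaired ht)

theorem IsAnswerSet.isKeyRepair [Nonempty Γ] (hM : IsAnswerSet (groundProgram S D q) M) :
    IsKeyRepair S D (D \ deletedFacts M) := by
  obtain ⟨hbase, hkeys, -, -⟩ := isModel_reduct_groundProgram_iff.1 hM.1
  refine ⟨⟨Set.sdiff_subset, hkeys.mono (Set.sdiff_subset_sdiff_left hbase)⟩, ?_⟩
  rintro K ⟨hKD, hK⟩ hMK f hf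
  have deleted_eq : deletedFacts M = D \ K := congrArg deletedFacts <|
    hM.eq_interpretation (Set.sdiff_subset_comm.1 hMK)
      ((Set.sdiff_sdiff_cancel_left hKD).symm ▸ hK)
  exact ⟨hKD hf, fun hf' => (deleted_eq ▸ hf').2 hf⟩

theorem isAnswerSet_iff_exists_isKeyRepair [Nonempty Γ] :
    IsAnswerSet (groundProgram S D q) M ↔
      ∃ K, IsKeyRepair S D K ∧ M = interpretation S q D (D \ K) K := by
  constructor
  · intro hM
    have hK := hM.isKeyRepair
    refine ⟨_, hK, hM.eq_interpretation ?_ ?_⟩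
    · rw [sdiff_sdiff_right_self]
      exact Set.inter_subset_right
    · rw [Set.sdiff_sdiff_cancel_left Set.sdiff_subset]
      exact hK.prop.2
  · rintro ⟨K, hK, rfl⟩
    exact hK.isAnswerSet

theorem isCautiousConsequence_query_iff [Nonempty Γ] :
    IsCautiousConsequence (factRules n D ∪ cqaProgram S q) (.query t) ↔
      ∀ K, IsKeyRepair S D K → t ∈ answers (perfectRewriting S q) K := by
  constructor
  · exact fun h K hK => h _ hK.isAnswerSet
  · intro h M hM
    obtain ⟨K, hK, rfl⟩ := isAnswerSet_iff_exists_isKeyRepair.1 hM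
    exact h K hK

end AnswerSets

section Repairs

/-! ### Loosely-sound repairs and key repairs -/

variable {S : Schema ar} {D B K : Set (DBFact ar Γ)}

theorem IsLooselySoundRepair.isKeyRepair [Infinite Γ] (hNKC : ∀ d ∈ S.inds, S.NKC d)
    (hD : D.Finite) (h : IsLooselySoundRepair S D B) : IsKeyRepair S D (B ∩ D) := by
  refine ⟨⟨Set.inter_subset_right, h.1.1.mono Set.inter_subset_left⟩, ?_⟩
  rintro K ⟨hKD, hK⟩ hBK
  by_contra hne
  obtain ⟨B', hKB', hB'⟩ := exists_consistent_superset hNKC (hD.subset hKD) hK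
  have hKB : K ⊆ B' ∩ D := Set.subset_inter hKB' hKD
  exact h.2 ⟨B', hB', hBK.trans hKB, fun hsub => hne (hKB.trans hsub)⟩

theorem IsKeyRepair.isLooselySoundRepair (h : IsKeyRepair S D K) (hKB : K ⊆ B)
    (hB : S.Consistent B) : IsLooselySoundRepair S D B := by
  refine ⟨hB, ?_⟩
  rintro ⟨B', hB', hsub, hne⟩
  have hKBD : K ⊆ B ∩ D := Set.subset_inter hKB h.prop.1
  exact hne ((h.le_of_ge ⟨Set.inter_subset_right, hB'.1.mono Set.inter_subset_left⟩
    (hKBD.trans hsub)).trans hKBD)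

theorem mem_consistentAnswers_iff [Infinite Γ] (hNKC : ∀ d ∈ S.inds, S.NKC d)
    (hD : D.Finite) {q : Finset (CQ ar Γ n)} {t : Fin n → Γ} :
    t ∈ consistentAnswers S D q ↔
      ∀ K, IsKeyRepair S D K → t ∈ answers (perfectRewriting S q) K := by
  constructor
  · intro ht K hK
    obtain ⟨B, hKB, hB, hBK⟩ := exists_consistent_superset_mem_answers
      (rewritingStep_perfectRewriting_subset S q) (perfectRewriting_finite S q) t hNKC
      (hD.subset hK.prop.1) hK.prop.2
    obtain ⟨c, hc, hct⟩ := ht B (hK.isLooselySoundRepair hKB hB)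
    exact hBK ⟨c, subset_perfectRewriting S q hc, hct⟩
  · intro ht B hB
    exact answers_perfectRewriting_subset hB.1.2
      (answers_mono Set.inter_subset_left (ht _ (hB.isKeyRepair hNKC hD)))

end Repairs

end CQA

theorem mainTheorem6_general {R Γ : Type*} [Infinite Γ] {ar : R → ℕ}
    (S : CQA.Schema ar) (hNKC : ∀ d ∈ S.inds, S.NKC d)
    (D : Set (CQA.DBFact ar Γ)) (hD : D.Finite) {n : ℕ} (q : Finset (CQA.CQ ar Γ n)) :
    (CQA.perfectRewriting S q).Finite ∧
      ∀ t : Fin n → Γ,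
        t ∈ CQA.consistentAnswers S D q ↔
          CQA.IsCautiousConsequence (CQA.factRules n D ∪ CQA.cqaProgram S q)
            (CQA.AspAtom.query t) :=
  ⟨CQA.perfectRewriting_finite S q, fun _ =>
    (CQA.mem_consistentAnswers_iff hNKC hD).trans CQA.isCautiousConsequence_query_iff.symm⟩

theorem mainTheorem6 {R Γ : Type*} [Infinite Γ] {ar : R → ℕ}
    (S : CQA.Schema ar) (hNKC : ∀ d ∈ S.inds, S.NKC d)
    (D : Set (CQA.DBFact ar Γ)) (hD : D.Finite)
    {n : ℕ} (q : Finset (CQA.CQ ar Γ n)) (hq : ∀ c ∈ q, c.Safe) :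
    (CQA.perfectRewriting S q).Finite ∧
      ∀ t : Fin n → Γ,
        t ∈ CQA.consistentAnswers S D q ↔
          CQA.IsCautiousConsequence (CQA.factRules n D ∪ CQA.cqaProgram S q)
            (CQA.AspAtom.query t) :=
  mainTheorem6_general S hNKC D hD q
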